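/- Let $X$ and $Y$ be real Banach spaces with $Y\neq\{0\}$; $B_{Y^*}$ is the closed unit ball of $Y^*$. *Notation.* Let $\Sigma$ be a $\sigma$-algebra of subsets of a set $\Omega$, and let $U_X(\Sigma)$ be the closure, in the supremum norm, of the $X$-valued $\Sigma$-simple functions. If $Z$ is a Banach space and $m:\Sigma\to L(X,Z)$ is finitely additive with finite semivariation $\widetilde m(\Omega)=\sup\|\sum_i m(A_i)x_i\|<\infty$ (supremum over finite partitions $(A_i)\subset\Sigma$ of $\Omega$ and $\|x_i\|\le 1$), then $f\mapsto\int f\,dm$ is the continuous extension to $U_X(\Sigma)$ of $\sum_i\chi_{A_i}x_i\mapsto\sum_i m(A_i)x_i$; in the same way $\int_A f\,d\mu\in X$ is defined for $A\in\Sigma$ and a positive, bounded, finitely additive $\mu:\Sigma\to[0,\infty)$. The variation $|\nu|(A)$ of a finitely additive $\nu$ is $\sup\sum_i\|\nu(A_i)\|$ over finite partitions $(A_i)\subset\Sigma$ of $A$. For a bounded linear $T:U_X(\Sigma)\to Y$, write $m\leftrightarrow T$ if $m:\Sigma\to L(X,Y)$ is finitely additive with finite semivariation and $T(f)=\int f\,dm$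 for all $f\in U_X(\Sigma)$; for $y^*\in Y^*$ let $m_{y^*}:\Sigma\to X^*$, $m_{y^*}(A)(x)=\langle y^*,m(A)(x)\rangle$. For a compact Hausdorff space $H$ with Borel $\sigma$-algebra $\Sigma$ one has $C(H,X)\subset U_X(\Sigma)$; for a bounded linear $T:C(H,X)\to Y$, write $m\leftrightarrow T$ if $m:\Sigma\to L(X,Y^{**})$ is finitely additive with finite semivariation, $T(f)=\int f\,dm$ (in $Y^{**}$) for all $f\in C(H,X)$, and $m$ is weakly regular, i.e. $|m_{y^*}|$ is regular for every $y^*\in Y^*$, where $m_{y^*}(A)(x)=\langle m(A)(x),y^*\rangle$. A finitely additive set function $\nu\ge 0$ on the Borel sets is regular if for every Borel set $E$ and $\varepsilon>0$ there are a compact $K$ and an open $U$ with $K\subset E\subset U$ and $\nu(U\setminus K)<\varepsilon$. In either case, for a finite partition $\pi\subset\Sigma$ and a positive, bounded, finitely additive $\mu$ on $\Sigma$, put $$T_\pi(f)=\sum_{A\in\pi}m(A)\left(\frac{\int_A f\,d\mu}{\mu(A)}\right),\qquad \tfrac00=0,$$ and let $T_\pi\to T$ mean convergence in operator norm of the net $(T_\pi)$,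 directed by refinement of partitions (for $T:C(H,X)\to Y$ the operators are regarded as operators into $Y^{**}\supset Y$). The family $\{|m_{y^*}|:y^*\in B_{Y^*}\}$ is uniformly absolutely continuous with respect to $\mu$ if for every $\varepsilon>0$ there is $\delta>0$ such that $|m_{y^*}|(A)<\varepsilon$ for all $y^*\in B_{Y^*}$ and all $A\in\Sigma$ with $\mu(A)<\delta$. A Banach space $Z$ has the Radon–Nikodým property if for every finite (countably additive) measure space $(\Omega,\Sigma,\mu)$, every countably additive $G:\Sigma\to Z$ of bounded variation with $G\ll\mu$ is of the form $G(E)=\int_E g\,d\mu$ ($E\in\Sigma$) with $g$ Bochner integrable. **Theorem 5.** The following are equivalent: 1. $X^*$ has the Radon–Nikodým property. 2. For every set $\Omega$ with a $\sigma$-algebra $\Sigma$, every compact operator $T:U_X(\Sigma)\to Y$ with $m\leftrightarrow T$, and every positive, bounded, finitely additive $\mu$ on $\Sigma$ with respect to which $\{|m_{y^*}|:y^*\in B_{Y^*}\}$ is uniformly absolutely continuous, $T_\pi\to T$. 3. For every compact Hausdorff space $H$, every compact operator $T:C(H,X)\to Y$ with $m\leftrightarrow T$, and every regular, positive, bounded,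 finitely additive $\mu$ on the Borel sets of $H$ with respect to which $\{|m_{y^*}|:y^*\in B_{Y^*}\}$ is uniformly absolutely continuous, $T_\pi\to T$. -/

import Mathlib

open MeasureTheory Filter Topology
open scoped ENNReal NNReal

set_option maxSynthPendingDepth 3

universe w₀ w₁ w₂ w u v

noncomputable section

namespace CondExpOp

/-! ### The Radon–Nikodým property -/

/-- A Banach space `Z` has the Radon–Nikodým property: for every finite measure space `(Ω, Σ, μ)`,
every countably additive `G : Σ → Z` of bounded variation with `G ≪ μ` has a Bochner integrable
density. -/
def HasRNP (Z : Type u) [NormedAddCommGroup Z] [NormedSpace ℝ Z] : Prop :=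
  ∀ (Ω : Type w) [MeasurableSpace Ω] (μ : Measure Ω) [IsFiniteMeasure μ]
    (G : VectorMeasure Ω Z),
    G.variation Set.univ < ∞ → G ≪ᵥ μ.toENNRealVectorMeasure →
    ∃ g : Ω → Z, Integrable g μ ∧ ∀ E : Set Ω, MeasurableSet E → G E = ∫ ω in E, g ω ∂μ

/-! ### Finitely additive set functions, variation and semivariation -/

section SetFunctions

variable {Ω X Z : Type*} [MeasurableSpace Ω]
  [NormedAddCommGroup X] [NormedSpace ℝ X] [NormedAddCommGroup Z] [NormedSpace ℝ Z]

/-- Finitely additive set functions on the σ-algebra of `Ω` with values in `G`. For `G = ℝ≥0` these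
are the positive, bounded, finitely additive measures. -/
abbrev FinAdd (Ω : Type*) [MeasurableSpace Ω] (G : Type*) [AddCommMonoid G] :=
  AddContent G {A : Set Ω | MeasurableSet A}

/-- Finite partitions of `Ω` into measurable sets. Here `π ≤ π'` means that `π` refines `π'`. -/
abbrev MPartition (Ω : Type*) [MeasurableSpace Ω] :=
  Finpartition (⊤ : Subtype (MeasurableSet : Set Ω → Prop))

theorem isSetRing_measurableSet : IsSetRing {A : Set Ω | MeasurableSet A} where
  empty_mem := MeasurableSet.empty
  union_mem _ _ hs ht := MeasurableSet.union hs ht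
  sdiff_mem _ _ hs ht := MeasurableSet.diff hs ht

/-- The variation `|m|(A) = sup ∑ ‖m(Aᵢ)‖` over the finite measurable partitions `(Aᵢ)` of `A`. -/
def variation (m : FinAdd Ω Z) (A : Set Ω) : ℝ≥0∞ :=
  preVariationFun (fun B => ‖m B‖ₑ) A

/-- The semivariation `sup ‖∑ m(Aᵢ) xᵢ‖` of an operator-valued `m` over the finite measurable
partitions `(Aᵢ)` of `A` and the vectors `xᵢ` in the closed unit ball of `X`. -/
def semivariation (m : FinAdd Ω (X →L[ℝ] Z)) (A : Subtype (MeasurableSet : Set Ω → Prop)) :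
    ℝ≥0∞ :=
  ⨆ (P : Finpartition A) (x : Set Ω → X) (_ : ∀ B, ‖x B‖ ≤ 1), ‖∑ B ∈ P.parts, m B (x B)‖ₑ

/-- For `φ ∈ Z*`, the set function `m_φ : Σ → X*`, `m_φ(A)(x) = ⟨φ, m(A)(x)⟩`. -/
def dualComp (m : FinAdd Ω (X →L[ℝ] Z)) (φ : StrongDual ℝ Z) : FinAdd Ω (StrongDual ℝ X) :=
  isSetRing_measurableSet.addContent_of_union (fun A => φ.comp (m A)) (by simp) (by
    intro s t hs ht hst
    rw [addContent_union isSetRing_measurableSet hs ht hst, ContinuousLinearMap.comp_add])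

/-- The set functions `ν i` are uniformly absolutely continuous with respect to `μ`:
`ν i (A) → 0` uniformly in `i` as `μ(A) → 0`. -/
def UniformlyAbsCont {ι : Type*} (ν : ι → Set Ω → ℝ≥0∞) (μ : FinAdd Ω ℝ≥0) : Prop :=
  ∀ ε : ℝ≥0, 0 < ε → ∃ δ : ℝ≥0, 0 < δ ∧
    ∀ A : Set Ω, MeasurableSet A → μ A < δ → ∀ i, ν i A < ε

/-- Regularity of a nonnegative set function on the Borel sets: every Borel set `E` lies between a
compact `K` and an open `U` with `ν (U \ K)` arbitrarily small. -/
def IsRegular {H : Type*} [TopologicalSpace H] [MeasurableSpace H] (ν : Set H → ℝ≥0∞) : Prop :=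
  ∀ E : Set H, MeasurableSet E → ∀ ε : ℝ≥0, 0 < ε →
    ∃ K U : Set H, IsCompact K ∧ IsOpen U ∧ K ⊆ E ∧ E ⊆ U ∧ ν (U \ K) < ε

end SetFunctions

/-! ### The space `U_X(Σ)` and integration against finitely additive set functions -/

section Integral

variable {Ω X Z : Type*} [MeasurableSpace Ω]
  [NormedAddCommGroup X] [NormedSpace ℝ X] [NormedAddCommGroup Z] [NormedSpace ℝ Z]

variable (Ω X) in
/-- The `X`-valued simple functions inside the space of bounded functions `Ω → X` with the
supremum norm. -/
def simpleToBdd : SimpleFunc Ω X →ₗ[ℝ] lp (fun _ : Ω => X) ∞ where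
  toFun s := ⟨fun ω => s ω, memℓp_infty_iff.2 (by
    obtain ⟨C, hC⟩ := s.exists_forall_norm_le
    exact ⟨C, by rintro _ ⟨ω, rfl⟩; exact hC ω⟩)⟩
  map_add' _ _ := rfl
  map_smul' _ _ := rfl

variable (Ω X) in
/-- `U_X(Σ)`: the uniform closure of the `X`-valued simple functions. -/
def USpace : Submodule ℝ (lp (fun _ : Ω => X) ∞) :=
  (LinearMap.range (simpleToBdd Ω X)).topologicalClosure

variable (Ω X) in
/-- The simple functions as elements of `U_X(Σ)`. -/
def simpleToU : SimpleFunc Ω X →ₗ[ℝ] USpace Ω X :=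
  (simpleToBdd Ω X).codRestrict (USpace Ω X) fun s =>
    Submodule.le_topologicalClosure _ (LinearMap.mem_range_self _ s)

/-- The integral `∫ s dm = ∑ m(s = x) x` of simple functions. -/
def simpleIntegral (m : FinAdd Ω (X →L[ℝ] Z)) : SimpleFunc Ω X →ₗ[ℝ] Z :=
  have hm : FinMeasAdditive (0 : Measure Ω) (m : Set Ω → X →L[ℝ] Z) :=
    fun _ _ hs ht _ _ hst => addContent_union isSetRing_measurableSet hs ht hst
  { toFun := fun s => s.setToSimpleFunc m
    map_add' := fun _ _ => SimpleFunc.setToSimpleFunc_add m hm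
      integrable_zero_measure integrable_zero_measure
    map_smul' := fun c _ => SimpleFunc.setToSimpleFunc_smul_real m hm c integrable_zero_measure }

/-- The integral `f ↦ ∫ f dm` on `U_X(Σ)`, for `m` of finite semivariation: the continuous extension
of the integral of simple functions. -/
def integral [CompleteSpace Z] (m : FinAdd Ω (X →L[ℝ] Z)) : USpace Ω X →L[ℝ] Z :=
  (simpleIntegral m).extendOfNorm (simpleToU Ω X)

/-- The operator-valued set function `B ↦ μ(A ∩ B) • id`. -/
def restrictId (X : Type*) [NormedAddCommGroup X] [NormedSpace ℝ X] (μ : FinAdd Ω ℝ≥0)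
    (A : Subtype (MeasurableSet : Set Ω → Prop)) : FinAdd Ω (X →L[ℝ] X) :=
  isSetRing_measurableSet.addContent_of_union
    (fun B => μ (A ∩ B) • ContinuousLinearMap.id ℝ X) (by simp) (by
      intro s t hs ht hst
      rw [Set.inter_union_distrib_left, addContent_union isSetRing_measurableSet
        (A.2.inter hs) (A.2.inter ht) (hst.mono Set.inter_subset_right Set.inter_subset_right),
        add_smul])

/-- The integral `f ↦ ∫_A f dμ ∈ X` on `U_X(Σ)` for a positive, bounded, finitely additive `μ`. -/
def setIntegral [CompleteSpace X] (μ : FinAdd Ω ℝ≥0)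
    (A : Subtype (MeasurableSet : Set Ω → Prop)) : USpace Ω X →L[ℝ] X :=
  integral (restrictId X μ A)

/-- The conditional expectation operator
`T_π(f) = ∑_{A ∈ π} m(A) (∫_A f dμ / μ(A))`, with `0 / 0 = 0`. -/
def condExpOp [CompleteSpace X] (μ : FinAdd Ω ℝ≥0) (m : FinAdd Ω (X →L[ℝ] Z))
    (π : MPartition Ω) : USpace Ω X →L[ℝ] Z :=
  ∑ A ∈ π.parts, (m A).comp ((μ A)⁻¹ • setIntegral μ A)

/-- `m ↔ T` for `T : U_X(Σ) → Y`: `m` has finite semivariation and `T f = ∫ f dm`. -/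
def RepresentsU [CompleteSpace Z] (m : FinAdd Ω (X →L[ℝ] Z)) (T : USpace Ω X →L[ℝ] Z) : Prop :=
  semivariation m ⊤ < ∞ ∧ ∀ f, T f = integral m f

end Integral

/-! ### Continuous functions on a compact space -/

section Continuous

variable {H X Y : Type*} [TopologicalSpace H] [CompactSpace H] [MeasurableSpace H] [BorelSpace H]
  [NormedAddCommGroup X] [NormedSpace ℝ X] [NormedAddCommGroup Y] [NormedSpace ℝ Y]

variable (H X) in
/-- `C(H, X)` inside the space of bounded functions. -/
def contToBdd : C(H, X) →ₗᵢ[ℝ] lp (fun _ : H => X) ∞ where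
  toFun f := ⟨fun h => f h, memℓp_infty_iff.2
    ⟨‖f‖, by rintro _ ⟨h, rfl⟩; exact f.norm_coe_le_norm h⟩⟩
  map_add' _ _ := rfl
  map_smul' _ _ := rfl
  norm_map' f := by
    rw [lp.norm_eq_ciSup, ContinuousMap.norm_eq_iSup_norm]
    rfl

theorem contToBdd_mem (f : C(H, X)) : contToBdd H X f ∈ USpace H X := by
  borelize X
  refine Metric.mem_closure_iff.2 fun ε hε => ?_
  obtain ⟨t, -, htf, hcov⟩ := (isCompact_range f.continuous).finite_cover_balls (half_pos hε)
  obtain ⟨l, hl⟩ : ∃ l : List X, ∀ x ∈ t, x ∈ l := ⟨htf.toFinset.toList, by simp⟩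
  let s : SimpleFunc H X :=
    (SimpleFunc.nearestPt (fun n => l.getD n 0) l.length).comp f f.continuous.measurable
  refine ⟨simpleToBdd H X s, ⟨s, rfl⟩, ?_⟩
  rw [dist_eq_norm]
  refine (lp.norm_le_of_forall_le (half_pos hε).le fun h => ?_).trans_lt (half_lt_self hε)
  obtain ⟨x, hx, hfx⟩ := Set.mem_iUnion₂.1 (hcov ⟨h, rfl⟩)
  obtain ⟨n, hn, rfl⟩ := List.getElem_of_mem (hl x hx)
  have h1 := SimpleFunc.edist_nearestPt_le (fun n => l.getD n 0) (f h) hn.le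
  have h2 : dist (s h) (f h) ≤ dist (l.getD n 0) (f h) := by
    rw [edist_dist, edist_dist] at h1
    exact (ENNReal.ofReal_le_ofReal_iff dist_nonneg).1 h1
  rw [List.getD_eq_getElem _ _ hn] at h2
  change ‖f h - s h‖ ≤ _
  rw [← dist_eq_norm, dist_comm]
  refine h2.trans ?_
  rw [dist_comm]
  exact (Metric.mem_ball.1 hfx).le

variable (H X) in
/-- The inclusion of `C(H, X)` into `U_X(Σ)`, `Σ` the Borel sets of `H`. -/
def contToU : C(H, X) →L[ℝ] USpace H X :=
  (contToBdd H X).toContinuousLinearMap.codRestrict (USpace H X) contToBdd_mem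

/-- For `y ∈ Y*`, the set function `m_y : Σ → X*` of an `L(X, Y**)`-valued `m`,
`m_y(A)(x) = m(A)(x)(y)`. -/
def bidualComp (m : FinAdd H (X →L[ℝ] StrongDual ℝ (StrongDual ℝ Y))) (y : StrongDual ℝ Y) :
    FinAdd H (StrongDual ℝ X) :=
  dualComp m (NormedSpace.inclusionInDoubleDual ℝ (StrongDual ℝ Y) y)

/-- `m ↔ T` for `T : C(H, X) → Y`: the set function `m : Σ → L(X, Y**)` has finite semivariation, is
weakly regular (each `|m_y|`, `y ∈ Y*`, is regular), and `T f = ∫ f dm` in `Y**`. -/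
def RepresentsC (m : FinAdd H (X →L[ℝ] StrongDual ℝ (StrongDual ℝ Y))) (T : C(H, X) →L[ℝ] Y) :
    Prop :=
  semivariation m ⊤ < ∞ ∧ (∀ y : StrongDual ℝ Y, IsRegular (variation (bidualComp m y))) ∧
    ∀ f, NormedSpace.inclusionInDoubleDual ℝ Y (T f) = integral m (contToU H X f)

end Continuous

end CondExpOp

end

/-! The operator `T_π` is the integral `∫ · dm` composed with the averaging operator `E_π` (`avg`)
on `U_X(Σ)`. The `E_π` are contractions, and `E_{π₀} E_π = E_{π₀}` when `π` refines `π₀`, so one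
partition with small error controls all its refinements. For an `X*`-valued `m` of bounded
variation, the norm of the integral is the total variation of `m`. The error `∫ · dm - (∫ · dm) E_π`
is the integral against `deviation μ m π`. Norm convergence for a functional therefore says exactly
that deviations of arbitrarily small total variation exist (`AveragesConverge`).

Statements 2 and 3 reduce to this property of `X*`-valued set functions. If `T` is compact, the
functionals `y ∘ T` with `‖y‖ ≤ 1` are totally bounded, so convergence for each `y` gives
convergence in operator norm. Conversely, every `X*`-valued `m` is recovered from a rank one
operator. On `C(H, X)`, regularity ensures that the norm of the integral is already computed on
continuous functions.

The Radon–Nikodým property concerns countably additive measures, while `μ` and `m` are only finitely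
additive. Suppose the averages fail to converge. A refining sequence of partitions, together with
partitions witnessing the failure, involves only countably many sets, which code a map from `Ω` to
the Cantor space. On clopen sets countable additivity is automatic by compactness, so `μ` and `m`
induce countably additive measures there, and the property provides a density. A continuous `L¹`
approximation of the density depends, up to a small error, on finitely many coordinates. A late
partition of the sequence decides these, so its deviation is small on its own witness, a
contradiction (`sum_enorm_deviation_le`, `averagesConverge_of_cantor`).

Conversely, if the averages of `G` converge, the step functions with values `G(A) / μ(A)` have an
`L¹` Cauchy sequence whose limit is a density. Convergence on the Cantor space alone yields
densities there, hence convergent averages and densities on every finite measure space. -/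

noncomputable section

namespace CondExpOp

/-! ### Finite measurable partitions -/

section Partitions

variable {Ω : Type*} [MeasurableSpace Ω]

/-- The Boolean algebra of measurable sets. -/
abbrev MSet (Ω : Type*) [MeasurableSpace Ω] := Subtype (MeasurableSet : Set Ω → Prop)

theorem MSet.disjoint_iff {A B : MSet Ω} : Disjoint A B ↔ Disjoint (A : Set Ω) B :=
  disjoint_subtype_iff (fun _ _ hs ht => hs.inter ht) MeasurableSet.empty

theorem MSet.coe_finset_sup {ι : Type*} (t : Finset ι) (B : ι → MSet Ω) :
    ((t.sup B : MSet Ω) : Set Ω) = ⋃ i ∈ t, (B i : Set Ω) := by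
  classical
  induction t using Finset.induction_on with
  | empty => simp
  | insert i t hi ih => simp [Finset.sup_insert, ← ih]

/-- A finite disjoint family of measurable sets is, up to empty members, a partition of its
union. -/
theorem exists_finpartition_sum_eq {ι : Type*} (t : Finset ι) (B : ι → MSet Ω) (A : MSet Ω)
    (hB : (t : Set ι).PairwiseDisjoint B) (hA : t.sup B = A) :
    ∃ P : Finpartition A, ∀ {M : Type*} [AddCommMonoid M] (f : MSet Ω → M), f ⊥ = 0 →
      ∑ p ∈ P.parts, f p = ∑ i ∈ t, f (B i) := by
  classical
  subst hA
  refine ⟨Finpartition.combine (fun i => (⊤ : Finpartition (B i))) hB.supIndep, fun f hf => ?_⟩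
  rw [Finpartition.sum_combine]
  refine Finset.sum_congr rfl fun i _ => ?_
  -- A `Finpartition` has no empty parts, so an empty `B i` contributes no part; its term on the
  -- right vanishes by `f ⊥ = 0`.
  by_cases h : B i = ⊥
  · have : (⊤ : Finpartition (B i)).parts = ∅ := Finpartition.parts_eq_empty_iff.2 h
    rw [this, h, hf, Finset.sum_empty]
  · have h1 := Finpartition.parts_top_subset (B i)
    have h2 := (⊤ : Finpartition (B i)).parts_nonempty h
    rw [(Finset.subset_singleton_iff.1 h1).resolve_left h2.ne_empty, Finset.sum_singleton]

namespace MPartition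

variable (π : MPartition Ω)

theorem exists_mem (ω : Ω) : ∃ A ∈ π.parts, ω ∈ (A : Set Ω) := by
  have h : ((π.parts.sup id : MSet Ω) : Set Ω) = Set.univ := by rw [π.sup_parts]; rfl
  rw [MSet.coe_finset_sup] at h
  simpa using h.ge (Set.mem_univ ω)

theorem pairwiseDisjoint : (π.parts : Set (MSet Ω)).PairwiseDisjoint (fun A => (A : Set Ω)) :=
  fun _ hA _ hB h => MSet.disjoint_iff.1 (π.disjoint hA hB h)

theorem eq_of_mem {A B : MSet Ω} (hA : A ∈ π.parts) (hB : B ∈ π.parts) {ω : Ω}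
    (h1 : ω ∈ (A : Set Ω)) (h2 : ω ∈ (B : Set Ω)) : A = B := by
  by_contra h
  exact Set.disjoint_left.1 (π.pairwiseDisjoint hA hB h) h1 h2

theorem iUnion_inter (B : Set Ω) : ⋃ A ∈ π.parts, (A : Set Ω) ∩ B = B := by
  ext ω
  obtain ⟨A, hA, h⟩ := π.exists_mem ω
  simp only [Set.mem_iUnion, Set.mem_inter_iff, exists_prop]
  exact ⟨fun ⟨_, _, _, h⟩ => h, fun hB => ⟨A, hA, h, hB⟩⟩

theorem sum_inter {M : Type*} [AddCommMonoid M] (m : FinAdd Ω M) {B : Set Ω}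
    (hB : MeasurableSet B) : ∑ A ∈ π.parts, m ((A : Set Ω) ∩ B) = m B := by
  conv_rhs => rw [← π.iUnion_inter B]
  exact (addContent_biUnion_eq isSetRing_measurableSet (fun A _ => A.2.inter hB)
    (π.pairwiseDisjoint.mono fun _ => Set.inter_subset_left)).symm

end MPartition

end Partitions

/-! ### The variation of a finitely additive set function -/

section Variation

variable {Ω Z : Type*} [MeasurableSpace Ω] [NormedAddCommGroup Z]

theorem FinAdd.union {M : Type*} [AddCommMonoid M] (m : FinAdd Ω M) {A B : Set Ω}
    (hA : MeasurableSet A) (hB : MeasurableSet B) (h : Disjoint A B) : m (A ∪ B) = m A + m B :=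
  addContent_union isSetRing_measurableSet hA hB h

/-- A finitely additive set function from its additivity on pairs. -/
def FinAdd.ofUnion {M : Type*} [AddCommMonoid M] (f : Set Ω → M) (h0 : f ∅ = 0)
    (h : ∀ {s t : Set Ω}, MeasurableSet s → MeasurableSet t → Disjoint s t →
      f (s ∪ t) = f s + f t) : FinAdd Ω M :=
  isSetRing_measurableSet.addContent_of_union f h0 h

@[simp]
theorem FinAdd.ofUnion_apply {M : Type*} [AddCommMonoid M] (f : Set Ω → M) (h0 : f ∅ = 0)
    (h : ∀ {s t : Set Ω}, MeasurableSet s → MeasurableSet t → Disjoint s t →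
      f (s ∪ t) = f s + f t) (A : Set Ω) : FinAdd.ofUnion f h0 h A = f A := rfl

theorem FinAdd.mono_nnreal (μ : FinAdd Ω ℝ≥0) {A B : Set Ω} (hA : MeasurableSet A)
    (hB : MeasurableSet B) (h : A ⊆ B) : μ A ≤ μ B := by
  rw [← Set.union_sdiff_cancel h, FinAdd.union μ hA (hB.diff hA) Set.disjoint_sdiff_right]
  exact le_self_add

theorem variation_mono (m : FinAdd Ω Z) {A B : Set Ω} (hB : MeasurableSet B) (h : A ⊆ B) :
    variation m A ≤ variation m B :=
  preVariation.mono _ hB h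

/-- The variation is defined by genuine partitions. This form admits disjoint families with empty
members that need not exhaust `A`, such as intersections with a partition or fibres of a simple
function. -/
theorem sum_enorm_le_variation (m : FinAdd Ω Z) {ι : Type*} (t : Finset ι) {B : ι → Set Ω}
    (hB : ∀ i ∈ t, MeasurableSet (B i)) (hd : (t : Set ι).PairwiseDisjoint B) {A : Set Ω}
    (hA : MeasurableSet A) (hBA : ∀ i ∈ t, B i ⊆ A) :
    ∑ i ∈ t, ‖m (B i)‖ₑ ≤ variation m A := by
  classical
  let B' : ι → MSet Ω := fun i => if h : i ∈ t then ⟨B i, hB i h⟩ else ⊥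
  have hB' : ∀ i ∈ t, (B' i : Set Ω) = B i := fun i hi => by simp [B', hi]
  obtain ⟨P, hP⟩ := exists_finpartition_sum_eq t B' (t.sup B') (fun i hi j hj hij => by
    have := hd hi hj hij
    refine MSet.disjoint_iff.2 ?_
    rw [hB' i hi, hB' j hj]
    exact this) rfl
  have h1 := hP (fun C : MSet Ω => ‖m C‖ₑ) (by simp)
  calc ∑ i ∈ t, ‖m (B i)‖ₑ = ∑ i ∈ t, ‖m (B' i)‖ₑ :=
        Finset.sum_congr rfl fun i hi => by rw [hB' i hi]
    _ = ∑ p ∈ P.parts, ‖m p‖ₑ := h1.symm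
    _ ≤ variation m A := by
        refine preVariation.sum_le_preVariationFun_of_subset (fun B => ‖m B‖ₑ) (t.sup B').2 hA ?_ P
        rw [MSet.coe_finset_sup]
        exact Set.iUnion₂_subset fun i hi => by rw [hB' i hi]; exact hBA i hi

theorem enorm_le_variation (m : FinAdd Ω Z) {A : Set Ω} (hA : MeasurableSet A) :
    ‖m A‖ₑ ≤ variation m A := by
  simpa using sum_enorm_le_variation m {()} (B := fun _ => A) (by simpa using hA) (by simp) hA
    (by simp)

theorem variation_le_iff (m : FinAdd Ω Z) {A : Set Ω} (hA : MeasurableSet A) {c : ℝ≥0∞} :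
    variation m A ≤ c ↔ ∀ P : Finpartition (⟨A, hA⟩ : MSet Ω), ∑ B ∈ P.parts, ‖m B‖ₑ ≤ c := by
  rw [variation, preVariationFun_apply _ hA, iSup_le_iff]

theorem sum_finpartition {M : Type*} [AddCommMonoid M] (m : FinAdd Ω M) {A : MSet Ω}
    (P : Finpartition A) : ∑ B ∈ P.parts, m B = m A := by
  have h : (A : Set Ω) = ⋃ B ∈ P.parts, (B : Set Ω) := by
    conv_lhs => rw [← P.sup_parts, MSet.coe_finset_sup]
    rfl
  rw [h]
  exact (addContent_biUnion_eq isSetRing_measurableSet (fun B _ => B.2)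
    fun B hB C hC hBC => MSet.disjoint_iff.1 (P.disjoint hB hC hBC)).symm

/-- The variation is the least additive majorant of the norm; most upper bounds below come from
exhibiting such a `v`. -/
theorem variation_le_of_enorm_le (m : FinAdd Ω Z) (v : FinAdd Ω ℝ≥0∞)
    (h : ∀ B, MeasurableSet B → ‖m B‖ₑ ≤ v B) {A : Set Ω} (hA : MeasurableSet A) :
    variation m A ≤ v A :=
  (variation_le_iff m hA).2 fun P =>
    (Finset.sum_le_sum fun (B : MSet Ω) _ => h B B.2).trans_eq (sum_finpartition v P)

/-- For `≤`, cut every part of a partition of the union along `A` and `B`. For `≥`, use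
superadditivity along the disjoint sequence `A, B, ∅, ∅, …`. -/
theorem variation_union (m : FinAdd Ω Z) {A B : Set Ω} (hA : MeasurableSet A)
    (hB : MeasurableSet B) (h : Disjoint A B) :
    variation m (A ∪ B) = variation m A + variation m B := by
  refine le_antisymm ((variation_le_iff m (hA.union hB)).2 fun P => ?_) ?_
  · have key : ∀ C : Set Ω, MeasurableSet C →
        ∑ D ∈ P.parts, ‖m (D ∩ C)‖ₑ ≤ variation m C := fun C hC =>
      sum_enorm_le_variation m P.parts (B := fun D : MSet Ω => (D : Set Ω) ∩ C)
        (fun D _ => D.2.inter hC)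
        (fun D hD E hE hDE => (MSet.disjoint_iff.1 (P.disjoint hD hE hDE)).mono
          Set.inter_subset_left Set.inter_subset_left) hC fun _ _ => Set.inter_subset_right
    refine le_trans ?_ (add_le_add (key A hA) (key B hB))
    rw [← Finset.sum_add_distrib]
    refine Finset.sum_le_sum fun D hD => ?_
    have : (D : Set Ω) = (D : Set Ω) ∩ A ∪ (D : Set Ω) ∩ B := by
      rw [← Set.inter_union_distrib_left]
      exact (Set.inter_eq_left.2 (P.le hD)).symm
    conv_lhs => rw [this, FinAdd.union m (D.2.inter hA) (D.2.inter hB)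
      (h.mono Set.inter_subset_right Set.inter_subset_right)]
    exact enorm_add_le _ _
  · have h1 := preVariation.sum_le_preVariationFun_iUnion (fun B => ‖m B‖ₑ)
      (s := fun n : ℕ => if n = 0 then A else if n = 1 then B else ∅)
      (fun n => by split_ifs <;> simp [hA, hB]) (by
        intro i j hij
        simp only [Function.onFun]
        split_ifs <;> simp_all [disjoint_comm])
    have h2 : (⋃ n : ℕ, if n = 0 then A else if n = 1 then B else ∅) = A ∪ B := by
      ext ω
      simp only [Set.mem_iUnion, Set.mem_union]
      constructor
      · rintro ⟨n, hn⟩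
        split_ifs at hn <;> simp_all
      · rintro (h | h)
        · exact ⟨0, by simpa⟩
        · exact ⟨1, by simpa⟩
    rw [h2] at h1
    refine le_trans ?_ h1
    refine le_trans ?_ (ENNReal.sum_le_tsum (Finset.range 2))
    simp [Finset.sum_range_succ, variation]

/-- The variation as a finitely additive set function. -/
def variationContent (m : FinAdd Ω Z) : FinAdd Ω ℝ≥0∞ :=
  FinAdd.ofUnion (variation m) (preVariation.empty _) (variation_union m)

@[simp]
theorem variationContent_apply (m : FinAdd Ω Z) (A : Set Ω) :
    variationContent m A = variation m A := rfl

end Variation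

/-! ### The integral on indicator functions -/

section IntegralBasics

variable {Ω X Z : Type*} [MeasurableSpace Ω]
  [NormedAddCommGroup X] [NormedSpace ℝ X] [NormedAddCommGroup Z] [NormedSpace ℝ Z]

theorem denseRange_simpleToU : DenseRange (simpleToU Ω X) := by
  intro f
  refine Metric.mem_closure_iff.2 fun ε hε => ?_
  obtain ⟨_, ⟨s, rfl⟩, hs⟩ := Metric.mem_closure_iff.1 f.2 ε hε
  exact ⟨simpleToU Ω X s, ⟨s, rfl⟩, hs⟩

theorem norm_apply_le (f : USpace Ω X) (ω : Ω) : ‖(f : lp (fun _ : Ω => X) ∞) ω‖ ≤ ‖f‖ :=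
  lp.norm_apply_le_norm ENNReal.top_ne_zero (f : lp (fun _ : Ω => X) ∞) ω

theorem norm_le_of_forall_apply {f : USpace Ω X} {C : ℝ} (hC : 0 ≤ C)
    (h : ∀ ω, ‖(f : lp (fun _ : Ω => X) ∞) ω‖ ≤ C) : ‖f‖ ≤ C :=
  lp.norm_le_of_forall_le hC h

theorem simpleToU_apply (s : SimpleFunc Ω X) (ω : Ω) :
    (simpleToU Ω X s : lp (fun _ : Ω => X) ∞) ω = s ω := rfl

/-- The function `χ_A c` as a simple function. -/
def indSimple {E : Type*} [Zero E] (A : MSet Ω) (c : E) : SimpleFunc Ω E :=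
  SimpleFunc.piecewise A A.2 (SimpleFunc.const Ω c) (SimpleFunc.const Ω 0)

open Classical in
theorem indSimple_apply {E : Type*} [Zero E] (A : MSet Ω) (c : E) (ω : Ω) :
    indSimple A c ω = if ω ∈ (A : Set Ω) then c else 0 := by
  simp [indSimple, SimpleFunc.piecewise_apply]

/-- The map `c ↦ χ_A c` from `X` to `U_X(Σ)`. -/
def indU (A : MSet Ω) : X →L[ℝ] USpace Ω X :=
  LinearMap.mkContinuous
    { toFun := fun c => simpleToU Ω X (indSimple A c)
      map_add' := fun c d => by
        rw [← map_add]
        congr 1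
        ext ω
        by_cases h : ω ∈ (A : Set Ω) <;> simp [indSimple_apply, h]
      map_smul' := fun r c => by
        rw [← map_smul]
        congr 1
        ext ω
        by_cases h : ω ∈ (A : Set Ω) <;> simp [indSimple_apply, h] }
    1 fun c => norm_le_of_forall_apply (by positivity) fun ω => by
      change ‖indSimple A c ω‖ ≤ _
      by_cases h : ω ∈ (A : Set Ω) <;> simp [indSimple_apply, h]

theorem indU_eq (A : MSet Ω) (c : X) : indU A c = simpleToU Ω X (indSimple A c) := rfl

theorem indU_apply_of_mem {A : MSet Ω} (c : X) {ω : Ω} (h : ω ∈ (A : Set Ω)) :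
    (indU A c : lp (fun _ : Ω => X) ∞) ω = c := by
  rw [indU_eq, simpleToU_apply, indSimple_apply, if_pos h]

theorem indU_apply_of_notMem {A : MSet Ω} (c : X) {ω : Ω} (h : ω ∉ (A : Set Ω)) :
    (indU A c : lp (fun _ : Ω => X) ∞) ω = 0 := by
  rw [indU_eq, simpleToU_apply, indSimple_apply, if_neg h]

theorem coe_sum_apply {ι : Type*} (t : Finset ι) (f : ι → USpace Ω X) (ω : Ω) :
    ((∑ i ∈ t, f i : USpace Ω X) : lp (fun _ : Ω => X) ∞) ω =
      ∑ i ∈ t, (f i : lp (fun _ : Ω => X) ∞) ω := by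
  classical
  induction t using Finset.induction_on with
  | empty => simp
  | insert i t hi ih => rw [Finset.sum_insert hi, Finset.sum_insert hi, ← ih]; rfl

theorem sum_indU_apply (π : MPartition Ω) (c : MSet Ω → X) {A : MSet Ω} (hA : A ∈ π.parts)
    {ω : Ω} (h : ω ∈ (A : Set Ω)) :
    ((∑ B ∈ π.parts, indU B (c B) : USpace Ω X) : lp (fun _ : Ω => X) ∞) ω = c A := by
  rw [coe_sum_apply, Finset.sum_eq_single A, indU_apply_of_mem _ h]
  · exact fun B hB hBA => indU_apply_of_notMem _ fun hω => hBA (π.eq_of_mem hB hA hω h)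
  · exact fun h => absurd hA h

theorem norm_sum_indU_le (π : MPartition Ω) (c : MSet Ω → X) {C : ℝ} (hC : 0 ≤ C)
    (h : ∀ A ∈ π.parts, ‖c A‖ ≤ C) : ‖∑ B ∈ π.parts, (indU B (c B) : USpace Ω X)‖ ≤ C :=
  norm_le_of_forall_apply hC fun ω => by
    obtain ⟨A, hA, hω⟩ := π.exists_mem ω
    rw [sum_indU_apply π c hA hω]
    exact h A hA

/-- Continuous linear maps on `U_X(Σ)` that agree on the functions `χ_A c` are equal. -/
theorem ext_indU {S T : USpace Ω X →L[ℝ] Z} (h : ∀ A c, S (indU A c) = T (indU A c)) : S = T := by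
  refine ContinuousLinearMap.ext fun f => ?_
  refine congrFun (denseRange_simpleToU.equalizer S.continuous T.continuous ?_) f
  funext s
  induction s using SimpleFunc.induction with
  | @const c A hA => exact h ⟨A, hA⟩ c
  | add _ hf hg =>
    simp only [Function.comp_apply] at hf hg ⊢
    rw [map_add, map_add, map_add, hf, hg]

/-- The integral of simple functions against `m` is bounded for the supremum norm. -/
def BoundedIntegral (m : FinAdd Ω (X →L[ℝ] Z)) : Prop :=
  ∃ C, ∀ s, ‖simpleIntegral m s‖ ≤ C * ‖simpleToU Ω X s‖

theorem simpleIntegral_eq_sum (m : FinAdd Ω (X →L[ℝ] Z)) (s : SimpleFunc Ω X) :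
    simpleIntegral m s = ∑ x ∈ s.range, m (s ⁻¹' {x}) x := rfl

theorem simpleIntegral_indSimple (m : FinAdd Ω (X →L[ℝ] Z)) (A : MSet Ω) (c : X) :
    simpleIntegral m (indSimple A c) = m A c :=
  SimpleFunc.setToSimpleFunc_indicator _ (by simp) A.2 c

theorem integral_simpleToU [CompleteSpace Z] {m : FinAdd Ω (X →L[ℝ] Z)} (hm : BoundedIntegral m)
    (s : SimpleFunc Ω X) : integral m (simpleToU Ω X s) = simpleIntegral m s :=
  LinearMap.extendOfNorm_eq (denseRange_simpleToU (Ω := Ω) (X := X)) hm s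

theorem integral_indU [CompleteSpace Z] {m : FinAdd Ω (X →L[ℝ] Z)} (hm : BoundedIntegral m)
    (A : MSet Ω) (c : X) : integral m (indU A c) = m A c := by
  rw [indU_eq, integral_simpleToU hm, simpleIntegral_indSimple]

theorem iUnion_fiber {E : Type*} (s : SimpleFunc Ω E) : ⋃ x ∈ s.range, s ⁻¹' {x} = Set.univ := by
  ext ω
  simp

theorem pairwiseDisjoint_fiber {E : Type*} (s : SimpleFunc Ω E) :
    (s.range : Set E).PairwiseDisjoint fun x => s ⁻¹' {x} :=
  fun _ _ _ _ h => Disjoint.preimage _ (Set.disjoint_singleton.2 h)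

/-- The fibre over `0` may leave `A` but contributes nothing; the other fibres are disjoint subsets
of `A`. -/
theorem enorm_simpleIntegral_le_variation (m : FinAdd Ω (X →L[ℝ] Z)) (s : SimpleFunc Ω X)
    {A : Set Ω} (hA : MeasurableSet A) (hs : ∀ ω ∉ A, s ω = 0) :
    ‖simpleIntegral m s‖ₑ ≤ variation m A * ‖simpleToU Ω X s‖ₑ := by
  classical
  rw [simpleIntegral_eq_sum]
  have h0 : ∑ x ∈ s.range, m (s ⁻¹' {x}) x = ∑ x ∈ s.range.erase 0, m (s ⁻¹' {x}) x := by
    by_cases h : (0 : X) ∈ s.range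
    · rw [← Finset.add_sum_erase _ _ h, map_zero, zero_add]
    · rw [Finset.erase_eq_of_notMem h]
  rw [h0]
  refine (enorm_sum_le _ _).trans ?_
  calc ∑ x ∈ s.range.erase 0, ‖m (s ⁻¹' {x}) x‖ₑ
      ≤ ∑ x ∈ s.range.erase 0, ‖m (s ⁻¹' {x})‖ₑ * ‖simpleToU Ω X s‖ₑ := by
        refine Finset.sum_le_sum fun x hx => ?_
        refine ((m (s ⁻¹' {x})).le_opENorm x).trans ?_
        gcongr
        obtain ⟨ω, rfl⟩ := SimpleFunc.mem_range.1 (Finset.mem_of_mem_erase hx)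
        rw [enorm_le_iff_norm_le]
        exact norm_apply_le (simpleToU Ω X s) ω
    _ ≤ _ := by
        rw [← Finset.sum_mul]
        gcongr
        refine sum_enorm_le_variation m _ (fun x _ => s.measurableSet_fiber x)
          ((pairwiseDisjoint_fiber s).subset (Finset.erase_subset _ _)) hA fun x hx ω hω => ?_
        by_contra h
        exact Finset.ne_of_mem_erase hx (hω.symm.trans (hs ω h))

theorem norm_simpleIntegral_le_variation {m : FinAdd Ω (X →L[ℝ] Z)} (s : SimpleFunc Ω X)
    {A : Set Ω} (hA : MeasurableSet A) (hs : ∀ ω ∉ A, s ω = 0) (hm : variation m A ≠ ∞) :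
    ‖simpleIntegral m s‖ ≤ (variation m A).toReal * ‖simpleToU Ω X s‖ := by
  have h := ENNReal.toReal_mono (ENNReal.mul_ne_top hm enorm_ne_top)
    (enorm_simpleIntegral_le_variation m s hA hs)
  rwa [ENNReal.toReal_mul, toReal_enorm, toReal_enorm] at h

theorem boundedIntegral_of_variation {m : FinAdd Ω (X →L[ℝ] Z)}
    (hm : variation m Set.univ ≠ ∞) : BoundedIntegral m :=
  ⟨_, fun s => norm_simpleIntegral_le_variation s MeasurableSet.univ (by simp) hm⟩

theorem norm_integral_le_variation [CompleteSpace Z] {m : FinAdd Ω (X →L[ℝ] Z)}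
    (hm : variation m Set.univ ≠ ∞) : ‖integral m‖ ≤ (variation m Set.univ).toReal :=
  LinearMap.opNorm_extendOfNorm_le (denseRange_simpleToU (Ω := Ω) (X := X)) ENNReal.toReal_nonneg
    fun s => norm_simpleIntegral_le_variation s MeasurableSet.univ (by simp) hm

/-- If `f ∈ U_X(Σ)` vanishes off `A`, then `‖∫ f dm‖ ≤ |m|(A) ‖f‖`. -/
theorem norm_integral_le_of_forall_notMem [CompleteSpace Z] {m : FinAdd Ω (X →L[ℝ] Z)}
    (hm : variation m Set.univ ≠ ∞) {A : Set Ω} (hA : MeasurableSet A) (f : USpace Ω X)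
    (hf : ∀ ω ∉ A, (f : lp (fun _ : Ω => X) ∞) ω = 0) :
    ‖integral m f‖ ≤ (variation m A).toReal * ‖f‖ := by
  have hmA : variation m A ≠ ∞ :=
    ((variation_mono m MeasurableSet.univ (Set.subset_univ A)).trans_lt hm.lt_top).ne
  refine le_of_forall_pos_le_add fun ε hε => ?_
  -- The errors below add up to `(C - 1) * (ε / C)`; the summand `1` makes `C` positive.
  set C := ‖integral m‖ + (variation m A).toReal + 1 with hC
  have hC0 : 0 < C := by positivity
  obtain ⟨_, ⟨s, rfl⟩, hs⟩ :=
    Metric.mem_closure_iff.1 (denseRange_simpleToU f) (ε / C) (by positivity)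
  -- Cutting the approximant off outside `A` does not worsen it, because `f` vanishes there.
  let s' : SimpleFunc Ω X := SimpleFunc.piecewise A hA s (SimpleFunc.const Ω 0)
  have hs'A : ∀ ω ∉ A, s' ω = 0 := fun ω h => by simp [s', SimpleFunc.piecewise_apply, h]
  have hd : ‖f - simpleToU Ω X s'‖ ≤ ε / C := by
    refine norm_le_of_forall_apply (by positivity) fun ω => ?_
    change ‖(f : lp (fun _ : Ω => X) ∞) ω - s' ω‖ ≤ _
    by_cases h : ω ∈ A
    · have : s' ω = s ω := by simp [s', SimpleFunc.piecewise_apply, h]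
      rw [this]
      refine (norm_apply_le (f - simpleToU Ω X s) ω).trans ?_
      rw [← dist_eq_norm]
      exact hs.le
    · rw [hf ω h, hs'A ω h, sub_zero, norm_zero]
      positivity
  have h1 := norm_simpleIntegral_le_variation s' hA hs'A hmA
  rw [← integral_simpleToU (boundedIntegral_of_variation hm)] at h1
  have h2 : ‖simpleToU Ω X s'‖ ≤ ‖f‖ + ε / C := by
    rw [show simpleToU Ω X s' = f - (f - simpleToU Ω X s') by abel]
    exact (norm_sub_le _ _).trans (by gcongr)
  have h3 : ‖integral m (f - simpleToU Ω X s')‖ ≤ ‖integral m‖ * (ε / C) :=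
    ((integral m).le_opNorm _).trans (by gcongr)
  calc ‖integral m f‖ = ‖integral m (f - simpleToU Ω X s') + integral m (simpleToU Ω X s')‖ := by
        rw [← map_add, sub_add_cancel]
    _ ≤ ‖integral m‖ * (ε / C) + (variation m A).toReal * (‖f‖ + ε / C) :=
        (norm_add_le _ _).trans (add_le_add h3 (h1.trans (by gcongr)))
    _ = (variation m A).toReal * ‖f‖ + (C - 1) * (ε / C) := by rw [hC]; ring
    _ ≤ _ := by
        gcongr
        calc (C - 1) * (ε / C) ≤ C * (ε / C) := by gcongr; linarith
          _ = ε := by field_simp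

/-- Divided by `‖s‖`, the values of `s` lie in the unit ball, so the normalised integral is one of
the sums in the semivariation. -/
theorem boundedIntegral_of_semivariation {m : FinAdd Ω (X →L[ℝ] Z)}
    (hm : semivariation m ⊤ < ∞) : BoundedIntegral m := by
  classical
  refine ⟨(semivariation m ⊤).toReal, fun s => ?_⟩
  rcases (norm_nonneg (simpleToU Ω X s)).eq_or_lt with h0 | h0
  · have hs : s = 0 := by
      ext ω
      exact norm_le_zero_iff.1 ((norm_apply_le (simpleToU Ω X s) ω).trans h0.ge)
    simp [hs]
  set r := ‖simpleToU Ω X s‖ with hr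
  have hsr : ∀ ω, ‖s ω‖ ≤ r := fun ω => norm_apply_le (simpleToU Ω X s) ω
  -- The vectors are indexed by sets: take the value of `s` at a chosen point, which on a fibre does
  -- not depend on the choice.
  let x : Set Ω → X := fun B => if h : B.Nonempty then r⁻¹ • s h.some else 0
  have hx : ∀ B, ‖x B‖ ≤ 1 := fun B => by
    by_cases h : B.Nonempty
    · simp only [x, h, dite_true, norm_smul, norm_inv, Real.norm_of_nonneg h0.le]
      rw [inv_mul_le_one₀ h0]
      exact hsr _
    · simp [x, h]
  obtain ⟨P, hP⟩ := exists_finpartition_sum_eq s.range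
    (fun c => (⟨s ⁻¹' {c}, s.measurableSet_fiber c⟩ : MSet Ω)) ⊤
    (fun c hc d hd hcd => MSet.disjoint_iff.2 (pairwiseDisjoint_fiber s hc hd hcd))
    (Subtype.ext (by rw [MSet.coe_finset_sup]; exact iUnion_fiber s))
  have h1 := hP (fun B : MSet Ω => m B (x B)) (by simp)
  have h2 : ∑ c ∈ s.range, m (s ⁻¹' {c}) (x (s ⁻¹' {c})) = r⁻¹ • simpleIntegral m s := by
    rw [simpleIntegral_eq_sum, Finset.smul_sum]
    refine Finset.sum_congr rfl fun c hc => ?_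
    obtain ⟨ω, rfl⟩ := SimpleFunc.mem_range.1 hc
    have hne : (s ⁻¹' {s ω}).Nonempty := ⟨ω, rfl⟩
    have : s hne.some = s ω := hne.some_mem
    simp only [x, hne, dite_true, this, map_smul]
  have h3 : ‖∑ B ∈ P.parts, m B (x B)‖ₑ ≤ semivariation m ⊤ :=
    le_iSup_of_le P (le_iSup_of_le x (le_iSup_of_le hx le_rfl))
  rw [h1, h2] at h3
  have h4 := ENNReal.toReal_mono hm.ne h3
  rw [toReal_enorm, norm_smul, norm_inv, Real.norm_of_nonneg h0.le, inv_mul_le_iff₀ h0] at h4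
  rwa [mul_comm]

/-- For `X*`-valued set functions, the variation is bounded by every bound for the sums
`∑ m(Aᵢ) xᵢ` over partitions and vectors in the unit ball. -/
theorem variation_le_of_forall_sum_le (m : FinAdd Ω (StrongDual ℝ X)) {C : ℝ}
    (h : ∀ (π : MPartition Ω) (x : Set Ω → X), (∀ B, ‖x B‖ ≤ 1) →
      ‖∑ B ∈ π.parts, m B (x B)‖ ≤ C) : variation m Set.univ ≤ ENNReal.ofReal C := by
  refine (variation_le_iff m MeasurableSet.univ).2 fun π => ?_
  have key : ∑ B ∈ π.parts, ‖m B‖ ≤ C := by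
    refine le_of_forall_pos_le_add fun ε hε => ?_
    -- The norm of a functional need not be attained; each part may lose `ε / N`, for a total of at
    -- most `ε`.
    set N : ℝ := π.parts.card + 1
    have hN : 0 < N := by positivity
    have hx : ∀ B : Set Ω, ∃ x : X, ‖x‖ ≤ 1 ∧ ‖m B‖ - ε / N ≤ m B x := fun B => by
      by_contra! hcon
      rcases lt_or_ge (‖m B‖ - ε / N) 0 with h0 | h0
      · have := hcon 0 (by simp)
        rw [map_zero] at this
        linarith
      have : ‖m B‖ ≤ ‖m B‖ - ε / N := by
        refine (m B).opNorm_le_of_unit_norm h0 fun x hx => ?_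
        rw [Real.norm_eq_abs, abs_le]
        have h1 := hcon x hx.le
        have h2 := hcon (-x) (by rw [norm_neg]; exact hx.le)
        rw [map_neg] at h2
        constructor <;> linarith
      have : 0 < ε / N := by positivity
      linarith
    choose x hx1 hx2 using hx
    have h1 := h π x hx1
    calc ∑ B ∈ π.parts, ‖m B‖ ≤ ∑ B ∈ π.parts, (m B (x B) + ε / N) :=
          Finset.sum_le_sum fun B _ => by have := hx2 B; linarith
      _ = ∑ B ∈ π.parts, m B (x B) + π.parts.card * (ε / N) := by
          rw [Finset.sum_add_distrib, Finset.sum_const, nsmul_eq_mul]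
      _ ≤ C + ε := by
          gcongr
          · exact (le_abs_self _).trans h1
          · calc (π.parts.card : ℝ) * (ε / N) ≤ N * (ε / N) := by gcongr; simp [N]
              _ = ε := by field_simp
  calc ∑ B ∈ π.parts, ‖m B‖ₑ = ∑ B ∈ π.parts, ENNReal.ofReal ‖m B‖ := by simp
    _ = ENNReal.ofReal (∑ B ∈ π.parts, ‖m B‖) :=
        (ENNReal.ofReal_sum_of_nonneg fun _ _ => norm_nonneg _).symm
    _ ≤ _ := ENNReal.ofReal_le_ofReal key

/-- Dual values are essential here: norming vectors chosen separately on each part assemble into one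
function in the unit ball of `U_X(Σ)`. With `norm_integral_le_variation` this identifies the norm
with the total variation. -/
theorem variation_le_norm_integral {m : FinAdd Ω (StrongDual ℝ X)} (hm : BoundedIntegral m) :
    variation m Set.univ ≤ ENNReal.ofReal ‖integral m‖ := by
  refine variation_le_of_forall_sum_le m fun π x hx => ?_
  have h1 : ∑ B ∈ π.parts, m B (x B) = integral m (∑ B ∈ π.parts, indU B (x B)) := by
    rw [map_sum]
    exact Finset.sum_congr rfl fun B _ => (integral_indU hm B (x B)).symm
  rw [h1]
  refine ((integral m).le_opNorm _).trans (mul_le_of_le_one_right (norm_nonneg _) ?_)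
  exact norm_sum_indU_le π (fun B => x B) zero_le_one fun B _ => hx B

theorem dualComp_apply (m : FinAdd Ω (X →L[ℝ] Z)) (φ : StrongDual ℝ Z) (A : Set Ω) :
    dualComp m φ A = φ.comp (m A) := rfl

/-- After composition with `φ` the sums over partitions are bounded by `‖φ‖` times the
semivariation, although `m` itself may have infinite variation. -/
theorem variation_dualComp_ne_top {m : FinAdd Ω (X →L[ℝ] Z)} (hm : semivariation m ⊤ < ∞)
    (φ : StrongDual ℝ Z) : variation (dualComp m φ) Set.univ ≠ ∞ := by
  refine ((variation_le_of_forall_sum_le (dualComp m φ)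
    (C := ‖φ‖ * (semivariation m ⊤).toReal) fun π x hx => ?_).trans_lt
    ENNReal.ofReal_lt_top).ne
  have h1 : ∑ B ∈ π.parts, dualComp m φ B (x B) = φ (∑ B ∈ π.parts, m B (x B)) := by
    rw [map_sum]
    rfl
  rw [h1]
  refine (φ.le_opNorm _).trans ?_
  gcongr
  have h3 : ‖∑ B ∈ π.parts, m B (x B)‖ₑ ≤ semivariation m ⊤ :=
    le_iSup_of_le π (le_iSup_of_le x (le_iSup_of_le hx le_rfl))
  simpa using ENNReal.toReal_mono hm.ne h3

theorem integral_dualComp [CompleteSpace Z] {m : FinAdd Ω (X →L[ℝ] Z)}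
    (hm : semivariation m ⊤ < ∞) (φ : StrongDual ℝ Z) :
    integral (dualComp m φ) = φ.comp (integral m) := by
  refine ext_indU fun A c => ?_
  rw [integral_indU (boundedIntegral_of_variation (variation_dualComp_ne_top hm φ)),
    ContinuousLinearMap.comp_apply, integral_indU (boundedIntegral_of_semivariation hm)]
  rfl

end IntegralBasics

/-! ### Averaging operators -/

section Averaging

variable {Ω X Z : Type*} [MeasurableSpace Ω]
  [NormedAddCommGroup X] [NormedSpace ℝ X] [NormedAddCommGroup Z] [NormedSpace ℝ Z]

/-- A positive finitely additive set function with extended values. -/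
def coeContent (μ : FinAdd Ω ℝ≥0) : FinAdd Ω ℝ≥0∞ :=
  FinAdd.ofUnion (fun B => (μ B : ℝ≥0∞)) (by simp) fun hs ht hst => by
    rw [FinAdd.union μ hs ht hst, ENNReal.coe_add]

theorem restrictId_apply (μ : FinAdd Ω ℝ≥0) (A : MSet Ω) (B : Set Ω) :
    restrictId X μ A B = μ (A ∩ B) • ContinuousLinearMap.id ℝ X := rfl

theorem variation_restrictId_le (μ : FinAdd Ω ℝ≥0) (A : MSet Ω) :
    variation (restrictId X μ A) Set.univ ≤ μ A := by
  let v : FinAdd Ω ℝ≥0∞ := FinAdd.ofUnion (fun B => (μ (A ∩ B) : ℝ≥0∞)) (by simp)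
    fun hs ht hst => by
      rw [Set.inter_union_distrib_left, FinAdd.union μ (A.2.inter hs) (A.2.inter ht)
        (hst.mono Set.inter_subset_right Set.inter_subset_right), ENNReal.coe_add]
  have hv : v Set.univ = μ A := by simp [v]
  rw [← hv]
  refine variation_le_of_enorm_le _ v (fun B hB => ?_) MeasurableSet.univ
  rw [restrictId_apply]
  have h : ‖μ (A ∩ B) • ContinuousLinearMap.id ℝ X‖₊ ≤ μ (A ∩ B) := by
    rw [← NNReal.coe_le_coe, coe_nnnorm]
    refine ContinuousLinearMap.opNorm_le_bound _ (NNReal.coe_nonneg _) fun x => ?_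
    rw [_root_.smul_apply, ContinuousLinearMap.id_apply, NNReal.smul_def, norm_smul,
      Real.norm_of_nonneg (NNReal.coe_nonneg _)]
  exact ENNReal.coe_le_coe.2 h

variable [CompleteSpace X]

theorem setIntegral_indU (μ : FinAdd Ω ℝ≥0) (A B : MSet Ω) (c : X) :
    setIntegral μ A (indU B c) = μ ((A : Set Ω) ∩ B) • c := by
  rw [setIntegral, integral_indU (boundedIntegral_of_variation
    ((variation_restrictId_le μ A).trans_lt ENNReal.coe_lt_top).ne)]
  rfl

theorem norm_setIntegral_le (μ : FinAdd Ω ℝ≥0) (A : MSet Ω) :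
    ‖(setIntegral μ A : USpace Ω X →L[ℝ] X)‖ ≤ μ A := by
  have h := variation_restrictId_le (X := X) μ A
  refine (norm_integral_le_variation (h.trans_lt ENNReal.coe_lt_top).ne).trans ?_
  exact ENNReal.toReal_mono ENNReal.coe_ne_top h

/-- The operator `f ↦ ∑_{A ∈ π} χ_A (∫_A f dμ / μ(A))` on `U_X(Σ)`. -/
def avg (μ : FinAdd Ω ℝ≥0) (π : MPartition Ω) : USpace Ω X →L[ℝ] USpace Ω X :=
  ∑ A ∈ π.parts, (indU A).comp ((μ A)⁻¹ • setIntegral μ A)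

theorem avg_apply (μ : FinAdd Ω ℝ≥0) (π : MPartition Ω) (f : USpace Ω X) :
    avg μ π f = ∑ A ∈ π.parts, indU A ((μ A)⁻¹ • setIntegral μ A f) := by
  simp [avg]

theorem norm_avg_le (μ : FinAdd Ω ℝ≥0) (π : MPartition Ω) :
    ‖(avg μ π : USpace Ω X →L[ℝ] USpace Ω X)‖ ≤ 1 := by
  refine ContinuousLinearMap.opNorm_le_bound _ zero_le_one fun f => ?_
  rw [avg_apply, one_mul]
  refine norm_sum_indU_le π (fun A => (μ A)⁻¹ • setIntegral μ A f) (norm_nonneg f) fun A _ => ?_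
  rw [NNReal.smul_def, norm_smul, Real.norm_of_nonneg (NNReal.coe_nonneg _), NNReal.coe_inv]
  have h := ((setIntegral μ A : USpace Ω X →L[ℝ] X).le_opNorm f).trans
    (mul_le_mul_of_nonneg_right (norm_setIntegral_le (X := X) μ A) (norm_nonneg f))
  rcases (NNReal.coe_nonneg (μ A)).eq_or_lt with h0 | h0
  · rw [← h0, inv_zero, zero_mul]
    exact norm_nonneg f
  · rwa [inv_mul_le_iff₀ h0]

/-- This factorisation separates the roles of `m` and `μ`: all approximation is done by contractions
that do not involve `m`. -/
theorem condExpOp_eq_comp_avg [CompleteSpace Z] (μ : FinAdd Ω ℝ≥0) {m : FinAdd Ω (X →L[ℝ] Z)}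
    (hm : BoundedIntegral m) (π : MPartition Ω) :
    condExpOp μ m π = (integral m).comp (avg μ π) := by
  ext f
  rw [ContinuousLinearMap.comp_apply, avg_apply, map_sum, condExpOp, _root_.sum_apply]
  refine Finset.sum_congr rfl fun A _ => ?_
  rw [integral_indU hm]
  rfl

theorem avg_indU (μ : FinAdd Ω ℝ≥0) (π : MPartition Ω) (B : MSet Ω) (c : X) :
    avg μ π (indU B c) = ∑ A ∈ π.parts, indU A (((μ A)⁻¹ * μ ((A : Set Ω) ∩ B)) • c) := by
  rw [avg_apply]
  exact Finset.sum_congr rfl fun A _ => by rw [setIntegral_indU, smul_smul]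

/-- If `μ A = 0`, monotonicity makes the right side vanish too, so the convention `0 / 0 = 0` does
no harm. -/
theorem inv_mul_self_mul_inter (μ : FinAdd Ω ℝ≥0) (A B : MSet Ω) :
    μ A * ((μ A)⁻¹ * μ ((A : Set Ω) ∩ B)) = μ ((A : Set Ω) ∩ B) := by
  by_cases h : μ A = 0
  · have : μ ((A : Set Ω) ∩ B) ≤ μ A :=
      FinAdd.mono_nnreal μ (A.2.inter B.2) A.2 Set.inter_subset_left
    rw [h, zero_mul]
    exact (le_antisymm (this.trans_eq h) zero_le).symm
  · rw [mul_inv_cancel_left₀ h]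

/-- The tower property: averaging over the parts of a finer partition preserves the integral over
every part of `π₀`. -/
theorem avg_comp_avg (μ : FinAdd Ω ℝ≥0) {π π₀ : MPartition Ω} (h : π ≤ π₀) :
    (avg μ π₀ : USpace Ω X →L[ℝ] USpace Ω X).comp (avg μ π) = avg μ π₀ := by
  have key : ∀ A₀ ∈ π₀.parts,
      (setIntegral μ A₀ : USpace Ω X →L[ℝ] X).comp (avg μ π) = setIntegral μ A₀ := by
    intro A₀ hA₀
    refine ext_indU fun B c => ?_
    rw [ContinuousLinearMap.comp_apply, avg_indU, map_sum, setIntegral_indU]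
    simp_rw [setIntegral_indU, smul_smul]
    rw [← Finset.sum_smul, ← π.sum_inter μ (A₀.2.inter B.2)]
    congr 1
    refine Finset.sum_congr rfl fun A hA => ?_
    -- By refinement `A` lies in a single part `A₁` of `π₀`; if `A₁ ≠ A₀`, then `A` misses `A₀` and
    -- both terms vanish.
    obtain ⟨A₁, hA₁, hAA₁⟩ := h hA
    by_cases hA₁₀ : A₁ = A₀
    · subst hA₁₀
      have hsub : (A : Set Ω) ⊆ A₁ := hAA₁
      rw [Set.inter_eq_right.2 hsub, inv_mul_self_mul_inter, ← Set.inter_assoc,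
        Set.inter_eq_left.2 hsub]
    · have hd : Disjoint (A : Set Ω) A₀ :=
        (π₀.pairwiseDisjoint hA₁ hA₀ hA₁₀).mono_left hAA₁
      rw [hd.symm.inter_eq, ← Set.inter_assoc, hd.inter_eq]
      simp
  refine ContinuousLinearMap.ext fun f => ?_
  rw [ContinuousLinearMap.comp_apply, avg_apply, avg_apply μ π₀ f]
  refine Finset.sum_congr rfl fun A hA => ?_
  rw [← DFunLike.congr_fun (key A hA) f]
  rfl

/-- By the tower property the error at `π` equals `D - D ∘ E_π`, where `D` is the error at `π₀`.
Thus one good partition yields convergence along the whole net. -/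
theorem norm_sub_comp_avg_le (μ : FinAdd Ω ℝ≥0) (ψ : USpace Ω X →L[ℝ] Z) {π π₀ : MPartition Ω}
    (h : π ≤ π₀) : ‖ψ - ψ.comp (avg μ π)‖ ≤ 2 * ‖ψ - ψ.comp (avg μ π₀)‖ := by
  set D := ψ - ψ.comp (avg μ π₀)
  have h1 : ψ - ψ.comp (avg μ π) = D - D.comp (avg μ π) := by
    simp only [D, ContinuousLinearMap.sub_comp, ContinuousLinearMap.comp_assoc, avg_comp_avg μ h]
    abel
  rw [h1, two_mul]
  refine (norm_sub_le _ _).trans (add_le_add_right ?_ _)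
  exact (ContinuousLinearMap.opNorm_comp_le _ _).trans
    (mul_le_of_le_one_right (norm_nonneg _) (norm_avg_le μ π))

end Averaging

/-! ### The deviation of a set function from its averages -/

section Deviation

variable {Ω X Z : Type*} [MeasurableSpace Ω]
  [NormedAddCommGroup X] [NormedSpace ℝ X] [NormedAddCommGroup Z] [NormedSpace ℝ Z]

/-- The set function `B ↦ m(B) - ∑_{A ∈ π} (μ(A ∩ B) / μ(A)) m(A)`. -/
def deviation (μ : FinAdd Ω ℝ≥0) (m : FinAdd Ω Z) (π : MPartition Ω) : FinAdd Ω Z :=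
  FinAdd.ofUnion (fun B => m B - ∑ A ∈ π.parts, ((μ A)⁻¹ * μ ((A : Set Ω) ∩ B)) • m A) (by simp)
    fun {s t} hs ht hst => by
      have h : ∀ A : MSet Ω,
          μ ((A : Set Ω) ∩ (s ∪ t)) = μ ((A : Set Ω) ∩ s) + μ ((A : Set Ω) ∩ t) := fun A => by
        rw [Set.inter_union_distrib_left]
        exact FinAdd.union μ (A.2.inter hs) (A.2.inter ht)
          (hst.mono Set.inter_subset_right Set.inter_subset_right)
      simp_rw [h, mul_add, add_smul, Finset.sum_add_distrib, FinAdd.union m hs ht hst]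
      abel

theorem deviation_apply (μ : FinAdd Ω ℝ≥0) (m : FinAdd Ω Z) (π : MPartition Ω) (B : Set Ω) :
    deviation μ m π B = m B - ∑ A ∈ π.parts, ((μ A)⁻¹ * μ ((A : Set Ω) ∩ B)) • m A := rfl

/-- Besides finiteness, this domination makes the deviation regular whenever `|m|` and `μ` are
regular. -/
theorem exists_variation_deviation_le (μ : FinAdd Ω ℝ≥0) (m : FinAdd Ω Z) (π : MPartition Ω) :
    ∃ C : ℝ≥0, ∀ B, MeasurableSet B →
      variation (deviation μ m π) B ≤ variation m B + C * μ B := by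
  set C : ℝ≥0 := ∑ A ∈ π.parts, (μ A)⁻¹ * ‖m A‖₊ with hC
  let v : FinAdd Ω ℝ≥0∞ := FinAdd.ofUnion (fun B => variation m B + C * μ B)
    (by simp [variation, preVariation.empty]) fun hs ht hst => by
      rw [variation_union m hs ht hst, FinAdd.union μ hs ht hst, ENNReal.coe_add]
      ring
  refine ⟨C, fun B hB => variation_le_of_enorm_le _ v (fun B hB => ?_) hB⟩
  rw [deviation_apply]
  refine enorm_sub_le.trans (add_le_add (enorm_le_variation m hB) ?_)
  have h : ‖∑ A ∈ π.parts, ((μ A)⁻¹ * μ ((A : Set Ω) ∩ B)) • m A‖₊ ≤ C * μ B := by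
    refine (nnnorm_sum_le _ _).trans ?_
    rw [hC, Finset.sum_mul]
    refine Finset.sum_le_sum fun A _ => ?_
    rw [NNReal.smul_def, nnnorm_smul, Real.nnnorm_of_nonneg (NNReal.coe_nonneg _)]
    calc (μ A)⁻¹ * μ ((A : Set Ω) ∩ B) * ‖m A‖₊
        ≤ (μ A)⁻¹ * μ B * ‖m A‖₊ := by
          gcongr
          exact FinAdd.mono_nnreal μ (A.2.inter hB) hB Set.inter_subset_right
      _ = _ := by ring
  exact_mod_cast h

theorem variation_deviation_ne_top (μ : FinAdd Ω ℝ≥0) {m : FinAdd Ω Z}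
    (hm : variation m Set.univ ≠ ∞) (π : MPartition Ω) :
    variation (deviation μ m π) Set.univ ≠ ∞ := by
  obtain ⟨C, hC⟩ := exists_variation_deviation_le μ m π
  refine ((hC _ MeasurableSet.univ).trans_lt ?_).ne
  exact ENNReal.add_lt_top.2 ⟨hm.lt_top, ENNReal.mul_lt_top ENNReal.coe_lt_top ENNReal.coe_lt_top⟩

/-- Averaging on functions is dual to averaging on set functions, so the operator error is itself an
integral and its norm can be compared with a variation. -/
theorem integral_deviation [CompleteSpace X] [CompleteSpace Z] (μ : FinAdd Ω ℝ≥0)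
    {m : FinAdd Ω (X →L[ℝ] Z)} (hm : variation m Set.univ ≠ ∞) (π : MPartition Ω) :
    integral (deviation μ m π) = integral m - (integral m).comp (avg μ π) := by
  have hb := boundedIntegral_of_variation hm
  refine ext_indU fun B c => ?_
  rw [integral_indU (boundedIntegral_of_variation (variation_deviation_ne_top μ hm π)),
    _root_.sub_apply, ContinuousLinearMap.comp_apply, avg_indU, map_sum,
    integral_indU hb, deviation_apply, _root_.sub_apply,
    _root_.sum_apply]
  congr 1
  refine Finset.sum_congr rfl fun A _ => ?_
  rw [integral_indU hb, _root_.smul_apply]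
  simp only [NNReal.smul_def, map_smul]

/-- The averages of `m` over finite partitions approximate `m` in variation. -/
def AveragesConverge (μ : FinAdd Ω ℝ≥0) (m : FinAdd Ω Z) : Prop :=
  ∀ ε : ℝ≥0, 0 < ε → ∃ π : MPartition Ω, variation (deviation μ m π) Set.univ ≤ ε

theorem AveragesConverge.tendsto [CompleteSpace X] {μ : FinAdd Ω ℝ≥0}
    {m : FinAdd Ω (StrongDual ℝ X)} (h : AveragesConverge μ m) (hm : variation m Set.univ ≠ ∞) :
    Tendsto (fun π : MPartition Ω => (integral m).comp (avg μ π)) atBot (𝓝 (integral m)) := by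
  classical
  rw [Metric.tendsto_nhds]
  intro ε hε
  -- Passing to refinements costs a factor `2`, so `ε / 4` leaves a bound `ε / 2 < ε`.
  obtain ⟨π₀, hπ₀⟩ := h (ε / 4).toNNReal (by simpa using hε)
  filter_upwards [eventually_le_atBot π₀] with π hπ
  rw [dist_comm, dist_eq_norm]
  refine (norm_sub_comp_avg_le μ _ hπ).trans_lt ?_
  rw [← integral_deviation μ hm]
  have h1 := (norm_integral_le_variation (variation_deviation_ne_top μ hm π₀)).trans
    (ENNReal.toReal_mono ENNReal.coe_ne_top hπ₀)
  rw [ENNReal.coe_toReal, Real.coe_toNNReal _ (by positivity)] at h1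
  linarith

theorem averagesConverge_of_tendsto [CompleteSpace X] {μ : FinAdd Ω ℝ≥0}
    {m : FinAdd Ω (StrongDual ℝ X)} (hm : variation m Set.univ ≠ ∞)
    (h : Tendsto (fun π : MPartition Ω => (integral m).comp (avg μ π)) atBot (𝓝 (integral m))) :
    AveragesConverge μ m := by
  classical
  intro ε hε
  obtain ⟨π, hπ⟩ := ((Metric.tendsto_nhds.1 h) ε (by exact_mod_cast hε)).exists
  refine ⟨π, (variation_le_norm_integral (boundedIntegral_of_variation
    (variation_deviation_ne_top μ hm π))).trans ?_⟩
  rw [integral_deviation μ hm, ← dist_eq_norm, dist_comm]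
  exact ENNReal.ofReal_le_of_le_toReal (by simpa using hπ.le)

end Deviation

/-! ### Uniform convergence on the range of a compact operator -/

section Compact

/-- The theorem of Schauder for the restriction of the adjoint to the dual unit ball: the functionals
`y ∘ T`, `‖y‖ ≤ 1`, have finite nets in norm. -/
theorem exists_finite_net_comp {E Y : Type*} [NormedAddCommGroup E] [NormedSpace ℝ E]
    [NormedAddCommGroup Y] [NormedSpace ℝ Y] {T : E →L[ℝ] Y} (hT : IsCompactOperator T)
    {ε : ℝ} (hε : 0 < ε) :
    ∃ F : Set (StrongDual ℝ Y), F.Finite ∧ F ⊆ Metric.closedBall 0 1 ∧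
      ∀ y ∈ Metric.closedBall (0 : StrongDual ℝ Y) 1, ∃ y' ∈ F, ‖(y - y').comp T‖ ≤ ε := by
  have htb : TotallyBounded (T '' Metric.closedBall 0 1) :=
    (hT.isCompact_closure_image_closedBall 1).totallyBounded.subset subset_closure
  obtain ⟨t, -, htf, hcov⟩ := Metric.finite_approx_of_totallyBounded htb (ε / 4) (by positivity)
  have : Fintype t := htf.fintype
  -- Evaluation at the finite net of `T(ball)` maps the dual ball to a bounded set in a
  -- finite-dimensional space, which is totally bounded.
  let R : StrongDual ℝ Y → t → ℝ := fun y i => y i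
  have hRb : TotallyBounded (R '' Metric.closedBall 0 1) := by
    refine (Bornology.IsBounded.isCompact_closure ?_).totallyBounded.subset subset_closure
    rw [isBounded_iff_forall_norm_le]
    refine ⟨∑ i : t, ‖(i : Y)‖, ?_⟩
    rintro _ ⟨y, hy, rfl⟩
    rw [pi_norm_le_iff_of_nonneg (by positivity)]
    intro i
    refine (y.le_opNorm _).trans ?_
    refine (mul_le_of_le_one_left (norm_nonneg _) (by simpa using hy)).trans ?_
    exact Finset.single_le_sum (f := fun i : t => ‖(i : Y)‖) (fun _ _ => norm_nonneg _)
      (Finset.mem_univ i)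
  obtain ⟨s, hs, hsf, hscov⟩ := Metric.finite_approx_of_totallyBounded hRb (ε / 4) (by positivity)
  choose! p hp using fun z (hz : z ∈ s) => hs hz
  refine ⟨p '' s, hsf.image p, by rintro _ ⟨z, hz, rfl⟩; exact (hp z hz).1, fun y hy => ?_⟩
  obtain ⟨z, hz, hyz⟩ := Set.mem_iUnion₂.1 (hscov ⟨y, hy, rfl⟩)
  refine ⟨p z, ⟨z, hz, rfl⟩, ?_⟩
  have hpz := hp z hz
  refine ContinuousLinearMap.opNorm_le_of_unit_norm hε.le fun x hx => ?_
  obtain ⟨a, ha, hxa⟩ := Set.mem_iUnion₂.1 (hcov ⟨x, by simpa using hx.le, rfl⟩)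
  -- Replacing `T x` by the net point `a` costs `2 * (ε / 4)`, as `‖y - p z‖ ≤ 2`; at `a` itself the
  -- functionals differ by at most `ε / 4`.
  have h1 : ‖(y - p z) (T x - a)‖ ≤ 2 * (ε / 4) := by
    refine (ContinuousLinearMap.le_opNorm _ _).trans ?_
    have h2 : ‖y - p z‖ ≤ 2 := by
      have h3 : ‖y‖ ≤ 1 := by simpa using hy
      have h4 : ‖p z‖ ≤ 1 := by simpa using hpz.1
      exact (norm_sub_le _ _).trans (by linarith)
    have h3 : ‖T x - a‖ ≤ ε / 4 := by rw [← dist_eq_norm]; exact (Metric.mem_ball.1 hxa).le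
    gcongr
  have h2 : ‖(y - p z) a‖ ≤ ε / 4 := by
    have h3 := (dist_le_pi_dist (R y) z ⟨a, ha⟩).trans (Metric.mem_ball.1 hyz).le
    rw [← hpz.2, dist_eq_norm] at h3
    exact h3
  calc ‖((y - p z).comp T) x‖ = ‖(y - p z) (T x - a) + (y - p z) a‖ := by
        rw [← map_add, sub_add_cancel]; rfl
    _ ≤ 2 * (ε / 4) + ε / 4 := (norm_add_le _ _).trans (add_le_add h1 h2)
    _ ≤ ε := by linarith

/-- Weak convergence `ℓ ∘ S ∘ P i → ℓ ∘ S`, for `ℓ` in a norming set on which the functionals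
`ℓ ∘ S` are totally bounded, implies `S ∘ P i → S` in norm. -/
theorem tendsto_comp_of_norming {E Z ι : Type*} [NormedAddCommGroup E] [NormedSpace ℝ E]
    [NormedAddCommGroup Z] [NormedSpace ℝ Z] {l : Filter ι} {S : E →L[ℝ] Z} {P : ι → E →L[ℝ] E}
    (hP : ∀ i, ‖P i‖ ≤ 1) {N : Set (StrongDual ℝ Z)}
    (hN : ∀ (z : Z) (C : ℝ), 0 ≤ C → (∀ φ ∈ N, ‖φ z‖ ≤ C) → ‖z‖ ≤ C)
    (hnet : ∀ ε > 0, ∃ F : Set (StrongDual ℝ Z), F.Finite ∧ F ⊆ N ∧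
      ∀ φ ∈ N, ∃ φ' ∈ F, ‖(φ - φ').comp S‖ ≤ ε)
    (h : ∀ φ ∈ N, Tendsto (fun i => (φ.comp S).comp (P i)) l (𝓝 (φ.comp S))) :
    Tendsto (fun i => S.comp (P i)) l (𝓝 S) := by
  rw [Metric.tendsto_nhds]
  intro ε hε
  obtain ⟨F, hF, hFN, hFnet⟩ := hnet (ε / 4) (by positivity)
  have h1 : ∀ᶠ i in l, ∀ φ ∈ F, dist ((φ.comp S).comp (P i)) (φ.comp S) < ε / 4 :=
    (Filter.eventually_all_finite hF).2 fun φ hφ =>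
      Metric.tendsto_nhds.1 (h φ (hFN hφ)) (ε / 4) (by positivity)
  filter_upwards [h1] with i hi
  rw [dist_eq_norm]
  -- Two quarters come from replacing `φ` by a net element, tested on `P i x - x` of norm at most `2
  -- * ‖x‖`; one comes from convergence at that element.
  refine lt_of_le_of_lt (b := 3 * (ε / 4)) ?_ (by linarith)
  refine ContinuousLinearMap.opNorm_le_bound _ (by positivity) fun x => ?_
  refine hN _ _ (by positivity) fun φ hφ => ?_
  obtain ⟨φ', hφ', hd⟩ := hFnet φ hφ
  have h2 : ‖(φ - φ').comp S (P i x - x)‖ ≤ ε / 4 * (2 * ‖x‖) := by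
    refine (ContinuousLinearMap.le_opNorm _ _).trans ?_
    gcongr
    refine (norm_sub_le _ _).trans ?_
    have := ((P i).le_opNorm x).trans (mul_le_of_le_one_left (norm_nonneg x) (hP i))
    linarith
  have h3 : ‖((φ'.comp S).comp (P i) - φ'.comp S) x‖ ≤ ε / 4 * ‖x‖ := by
    refine (ContinuousLinearMap.le_opNorm _ _).trans ?_
    gcongr
    rw [← dist_eq_norm]
    exact (hi φ' hφ').le
  have h4 : φ ((S.comp (P i) - S) x) =
      (φ - φ').comp S (P i x - x) + ((φ'.comp S).comp (P i) - φ'.comp S) x := by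
    simp only [ContinuousLinearMap.comp_apply, _root_.sub_apply, map_sub]
    ring
  rw [h4]
  refine (norm_add_le _ _).trans ((add_le_add h2 h3).trans_eq ?_)
  ring

end Compact

/-! ### Regular set functions and continuous functions -/

section Regular

/-- Continuous functions with prescribed values on finitely many disjoint compact sets. -/
theorem exists_continuous_eq_on_compacts {H X ι : Type*} [TopologicalSpace H] [CompactSpace H]
    [T2Space H] [NormedAddCommGroup X] [NormedSpace ℝ X] (t : Finset ι) (K : ι → Set H)
    (hK : ∀ i ∈ t, IsCompact (K i)) (hd : (t : Set ι).PairwiseDisjoint K) (x : ι → X) {C : ℝ}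
    (hC : 0 ≤ C) (hx : ∀ i ∈ t, ‖x i‖ ≤ C) :
    ∃ g : C(H, X), (∀ h, ‖g h‖ ≤ C) ∧ ∀ i ∈ t, ∀ h ∈ K i, g h = x i := by
  classical
  have hf : ∀ i, ∃ f : C(H, ℝ), i ∈ t →
      ((∀ j ∈ t, j ≠ i → ∀ h ∈ K j, f h = 0) ∧ (∀ h ∈ K i, f h = 1) ∧ ∀ h, 0 ≤ f h) := by
    intro i
    by_cases hi : i ∈ t
    · obtain ⟨f, hf0, hf1, hf⟩ := exists_continuous_zero_one_of_isClosed
        (s := ⋃ j ∈ t.erase i, K j) (t := K i)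
        (isClosed_biUnion_finset fun j hj => (hK j (Finset.mem_of_mem_erase hj)).isClosed)
        (hK i hi).isClosed (by
          rw [Set.disjoint_iUnion₂_left]
          exact fun j hj => hd (Finset.mem_of_mem_erase hj) hi (Finset.ne_of_mem_erase hj))
      exact ⟨f, fun _ => ⟨fun j hj hji h hh => hf0 (Set.mem_iUnion₂.2
        ⟨j, Finset.mem_erase.2 ⟨hji, hj⟩, hh⟩), fun h hh => hf1 hh, fun h => (hf h).1⟩⟩
    · exact ⟨0, fun h => absurd h hi⟩
  choose f hf using hf
  -- Dividing Urysohn functions by `D` makes their sum at most `1`, which gives the bound `C`. On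
  -- each `K i` the sum is already `1`, so prescribed values survive.
  let D : H → ℝ := fun h => max 1 (∑ i ∈ t, f i h)
  have hD : ∀ h, 0 < D h := fun h => lt_max_of_lt_left one_pos
  have hDc : Continuous D := continuous_const.max
    (continuous_finsetSum _ fun i _ => (f i).continuous)
  refine ⟨⟨fun h => (D h)⁻¹ • ∑ i ∈ t, f i h • x i, ?_⟩, fun h => ?_, fun i hi h hh => ?_⟩
  · exact (hDc.inv₀ fun h => (hD h).ne').smul
      (continuous_finsetSum _ fun i _ => (f i).continuous.smul continuous_const)
  · change ‖(D h)⁻¹ • ∑ i ∈ t, f i h • x i‖ ≤ C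
    rw [norm_smul, norm_inv, Real.norm_of_nonneg (hD h).le, inv_mul_le_iff₀ (hD h)]
    calc ‖∑ i ∈ t, f i h • x i‖ ≤ ∑ i ∈ t, f i h * C := norm_sum_le_of_le _ fun i hi => by
          rw [norm_smul, Real.norm_of_nonneg ((hf i hi).2.2 h)]
          exact mul_le_mul_of_nonneg_left (hx i hi) ((hf i hi).2.2 h)
      _ = (∑ i ∈ t, f i h) * C := by rw [Finset.sum_mul]
      _ ≤ D h * C := by gcongr; exact le_max_right _ _
  · change (D h)⁻¹ • ∑ j ∈ t, f j h • x j = x i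
    have h1 : ∀ j ∈ t, j ≠ i → f j h = 0 := fun j hj hji => (hf j hj).1 i hi hji.symm h hh
    have h2 : f i h = 1 := (hf i hi).2.1 h hh
    have h3 : ∑ j ∈ t, f j h = 1 := by
      rw [Finset.sum_eq_single i h1 (fun h => absurd hi h), h2]
    have h4 : ∑ j ∈ t, f j h • x j = x i := by
      rw [Finset.sum_eq_single i (fun j hj hji => by rw [h1 j hj hji, zero_smul])
        (fun h => absurd hi h), h2, one_smul]
    simp only [D]
    rw [h3, h4, max_self, inv_one, one_smul]

variable {H X : Type*} [TopologicalSpace H] [CompactSpace H] [T2Space H] [MeasurableSpace H]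
  [BorelSpace H] [NormedAddCommGroup X] [NormedSpace ℝ X]

/-- For a set function of regular variation, the norm of the integral on `U_X(Σ)` is attained on
continuous functions. -/
theorem norm_integral_le_of_isRegular {m : FinAdd H (StrongDual ℝ X)}
    (hm : variation m Set.univ ≠ ∞) (hr : IsRegular (variation m)) (f : USpace H X) :
    ‖integral m f‖ ≤ ‖(integral m).comp (contToU H X)‖ * ‖f‖ := by
  classical
  refine DenseRange.induction_on denseRange_simpleToU f
    (isClosed_le (by fun_prop) (by fun_prop)) fun s => ?_
  set C := ‖simpleToU H X s‖ with hC
  have hC0 : 0 ≤ C := norm_nonneg _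
  refine le_of_forall_pos_le_add fun ε hε => ?_
  -- There are `s.range.card` exceptional sets, and `s - g` has norm at most `2 * C`; the added ones
  -- keep `N` positive.
  set N : ℝ := (s.range.card + 1) * (2 * C + 1) with hN
  have hN0 : 0 < N := by positivity
  have hK := fun x : X => hr (s ⁻¹' {x}) (s.measurableSet_fiber x) (ε / N).toNNReal
    (by simpa using div_pos hε hN0)
  choose K U hK hU hKE hEU hv using hK
  obtain ⟨g, hgC, hgK⟩ := exists_continuous_eq_on_compacts s.range K (fun x _ => hK x)
    ((pairwiseDisjoint_fiber s).mono fun x => hKE x) (fun x => x) hC0 (fun x hx => by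
      obtain ⟨ω, rfl⟩ := SimpleFunc.mem_range.1 hx
      exact norm_apply_le (simpleToU H X s) ω)
  -- Outside `A` the continuous `g` agrees with `s`.
  set A : Set H := ⋃ x ∈ s.range, s ⁻¹' {x} \ K x with hA
  have hKm : ∀ x, MeasurableSet (s ⁻¹' {x} \ K x) := fun x =>
    (s.measurableSet_fiber x).diff (hK x).isClosed.measurableSet
  have hAm : MeasurableSet A := Finset.measurableSet_biUnion _ fun x _ => hKm x
  have hvA : variation m A ≤ ENNReal.ofReal (s.range.card * (ε / N)) := by
    have h1 : variationContent m A = ∑ x ∈ s.range, variationContent m (s ⁻¹' {x} \ K x) :=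
      addContent_biUnion_eq isSetRing_measurableSet (fun x _ => hKm x)
        ((pairwiseDisjoint_fiber s).mono fun x => Set.sdiff_subset)
    rw [← variationContent_apply, h1]
    calc ∑ x ∈ s.range, variation m (s ⁻¹' {x} \ K x)
        ≤ ∑ _x ∈ s.range, ENNReal.ofReal (ε / N) := by
          refine Finset.sum_le_sum fun x _ => le_trans ?_ (hv x).le
          exact variation_mono m ((hU x).measurableSet.diff (hK x).isClosed.measurableSet)
            (Set.sdiff_subset_sdiff_left (hEU x))
      _ = _ := by
          rw [Finset.sum_const, nsmul_eq_mul, ENNReal.ofReal_mul (by positivity),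
            ENNReal.ofReal_natCast]
  have hdiff : ‖integral m (simpleToU H X s - contToU H X g)‖ ≤ ε := by
    refine (norm_integral_le_of_forall_notMem hm hAm _ fun ω hω => ?_).trans ?_
    · change s ω - g ω = 0
      have hωK : ω ∈ K (s ω) := by
        by_contra h
        exact hω (Set.mem_iUnion₂.2 ⟨s ω, SimpleFunc.mem_range_self s ω, rfl, h⟩)
      rw [hgK (s ω) (SimpleFunc.mem_range_self s ω) ω hωK, sub_self]
    · have h1 : (variation m A).toReal ≤ s.range.card * (ε / N) :=
        ENNReal.toReal_le_of_le_ofReal (by positivity) hvA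
      have h2 : ‖simpleToU H X s - contToU H X g‖ ≤ 2 * C := by
        refine norm_le_of_forall_apply (by positivity) fun ω => ?_
        change ‖s ω - g ω‖ ≤ 2 * C
        have := norm_apply_le (simpleToU H X s) ω
        exact (norm_sub_le _ _).trans ((add_le_add this (hgC ω)).trans_eq (two_mul C).symm)
      calc (variation m A).toReal * ‖simpleToU H X s - contToU H X g‖
          ≤ (s.range.card * (ε / N)) * (2 * C) := by gcongr
        _ ≤ ((s.range.card + 1) * (ε / N)) * (2 * C + 1) := by gcongr <;> linarith
        _ = ε := by rw [hN]; field_simp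
  have hg : ‖integral m (contToU H X g)‖ ≤ ‖(integral m).comp (contToU H X)‖ * C := by
    refine (((integral m).comp (contToU H X)).le_opNorm g).trans ?_
    gcongr
    exact (ContinuousMap.norm_le g hC0).2 hgC
  calc ‖integral m (simpleToU H X s)‖
      = ‖integral m (contToU H X g) + integral m (simpleToU H X s - contToU H X g)‖ := by
        rw [← map_add, add_sub_cancel]
    _ ≤ _ := (norm_add_le _ _).trans (add_le_add hg hdiff)

theorem opNorm_integral_le_of_isRegular {m : FinAdd H (StrongDual ℝ X)}
    (hm : variation m Set.univ ≠ ∞) (hr : IsRegular (variation m)) :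
    ‖integral m‖ ≤ ‖(integral m).comp (contToU H X)‖ :=
  ContinuousLinearMap.opNorm_le_bound _ (norm_nonneg _) (norm_integral_le_of_isRegular hm hr)

end Regular

/-! ### Convergence of the operators from convergence of the averages -/

section OfAverages

/-- By Hahn–Banach the dual ball is norming, and compactness of `T` supplies the finite nets; only
convergence for single functionals remains. -/
theorem tendsto_condExpOp_of_averagesConverge {Ω X Y : Type*} [MeasurableSpace Ω]
    [NormedAddCommGroup X] [NormedSpace ℝ X] [CompleteSpace X]
    [NormedAddCommGroup Y] [NormedSpace ℝ Y] [CompleteSpace Y]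
    {T : USpace Ω X →L[ℝ] Y} {m : FinAdd Ω (X →L[ℝ] Y)} {μ : FinAdd Ω ℝ≥0}
    (hmT : RepresentsU m T) (hT : IsCompactOperator T)
    (h : ∀ y ∈ Metric.closedBall (0 : StrongDual ℝ Y) 1, AveragesConverge μ (dualComp m y)) :
    Tendsto (fun π : MPartition Ω => condExpOp μ m π) atBot (𝓝 T) := by
  obtain rfl : T = integral m := ContinuousLinearMap.ext hmT.2
  simp_rw [condExpOp_eq_comp_avg μ (boundedIntegral_of_semivariation hmT.1)]
  refine tendsto_comp_of_norming (norm_avg_le μ) (N := Metric.closedBall 0 1)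
    (fun z C hC hz => ?_) (fun ε hε => exists_finite_net_comp hT hε) fun φ hφ => ?_
  · obtain ⟨g, hg, hgz⟩ := exists_dual_vector'' ℝ z
    have := hz g (by simpa using hg)
    rwa [hgz, RCLike.ofReal_real_eq_id, id_eq, norm_norm] at this
  · rw [← integral_dualComp hmT.1]
    exact (h φ hφ).tendsto (variation_dualComp_ne_top hmT.1 φ)

/-- Averages of continuous functions need not be continuous, so convergence is proved on `U_X(Σ)`
and then restricted. Compactness gives nets for `y ∘ T` only on `C(H, X)`; weak regularity carries
the estimates over to `U_X(Σ)`. In `Y***` the image of the ball of `Y*` suffices as a norming set.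
-/
theorem tendsto_condExpOp_comp_of_averagesConverge {H X Y : Type*}
    [TopologicalSpace H] [CompactSpace H] [T2Space H] [MeasurableSpace H] [BorelSpace H]
    [NormedAddCommGroup X] [NormedSpace ℝ X] [CompleteSpace X]
    [NormedAddCommGroup Y] [NormedSpace ℝ Y]
    {T : C(H, X) →L[ℝ] Y} {m : FinAdd H (X →L[ℝ] StrongDual ℝ (StrongDual ℝ Y))}
    {μ : FinAdd H ℝ≥0} (hmT : RepresentsC m T) (hT : IsCompactOperator T)
    (h : ∀ y ∈ Metric.closedBall (0 : StrongDual ℝ Y) 1, AveragesConverge μ (bidualComp m y)) :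
    Tendsto (fun π : MPartition H => (condExpOp μ m π).comp (contToU H X)) atBot
      (𝓝 ((NormedSpace.inclusionInDoubleDual ℝ Y).comp T)) := by
  have hT' : (NormedSpace.inclusionInDoubleDual ℝ Y).comp T =
      (integral m).comp (contToU H X) := ContinuousLinearMap.ext hmT.2.2
  have hm_int : ∀ y : StrongDual ℝ Y, integral (bidualComp m y) =
      (NormedSpace.inclusionInDoubleDual ℝ (StrongDual ℝ Y) y).comp (integral m) :=
    fun y => integral_dualComp hmT.1 _
  have hvar : ∀ y : StrongDual ℝ Y, variation (bidualComp m y) Set.univ ≠ ∞ :=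
    fun y => variation_dualComp_ne_top hmT.1 _
  have key : Tendsto (fun π : MPartition H => condExpOp μ m π) atBot (𝓝 (integral m)) := by
    simp_rw [condExpOp_eq_comp_avg μ (boundedIntegral_of_semivariation hmT.1)]
    refine tendsto_comp_of_norming (norm_avg_le μ)
      (N := NormedSpace.inclusionInDoubleDual ℝ (StrongDual ℝ Y) '' Metric.closedBall 0 1)
      (fun z C hC hz => ?_) (fun ε hε => ?_) ?_
    · refine z.opNorm_le_of_unit_norm hC fun y hy => ?_
      exact hz _ ⟨y, by simpa using hy.le, rfl⟩
    · obtain ⟨F, hF, hFb, hFnet⟩ := exists_finite_net_comp hT hε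
      refine ⟨_, hF.image _, Set.image_mono hFb, ?_⟩
      rintro _ ⟨y, hy, rfl⟩
      obtain ⟨y', hy', hd⟩ := hFnet y hy
      refine ⟨_, ⟨y', hy', rfl⟩, ?_⟩
      rw [← map_sub, ← hm_int]
      refine (opNorm_integral_le_of_isRegular (hvar _) (hmT.2.1 _)).trans ?_
      rw [hm_int, ContinuousLinearMap.comp_assoc, ← hT']
      exact hd
    · rintro _ ⟨y, hy, rfl⟩
      rw [← hm_int]
      exact (h y hy).tendsto (hvar y)
  rw [hT']
  exact ((ContinuousLinearMap.compL ℝ (C(H, X)) (USpace H X) _).flip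
    (contToU H X)).continuous.tendsto _ |>.comp key

end OfAverages

/-! ### Convergence of the averages from rank one operators -/

section RankOne

variable {Ω X Z : Type*} [MeasurableSpace Ω]
  [NormedAddCommGroup X] [NormedSpace ℝ X] [NormedAddCommGroup Z] [NormedSpace ℝ Z]

/-- The operator-valued set function `A ↦ (x ↦ m(A)(x) z)`. -/
def rankOne (m : FinAdd Ω (StrongDual ℝ X)) (z : Z) : FinAdd Ω (X →L[ℝ] Z) :=
  FinAdd.ofUnion (fun A => (m A).smulRight z) (by ext; simp) fun hs ht hst => by
    ext x
    simp [FinAdd.union m hs ht hst, add_smul]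

theorem rankOne_apply (m : FinAdd Ω (StrongDual ℝ X)) (z : Z) (A : Set Ω) :
    rankOne m z A = (m A).smulRight z := rfl

theorem variation_le_mul {E E' : Type*} [NormedAddCommGroup E] [NormedAddCommGroup E']
    {m : FinAdd Ω E} {m' : FinAdd Ω E'} {c : ℝ≥0∞} (h : ∀ A, MeasurableSet A → ‖m' A‖ₑ ≤ c * ‖m A‖ₑ)
    {A : Set Ω} (hA : MeasurableSet A) : variation m' A ≤ c * variation m A := by
  let v : FinAdd Ω ℝ≥0∞ := FinAdd.ofUnion (fun B => c * variation m B)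
    (by simp [variation, preVariation.empty]) fun hs ht hst => by
      rw [variation_union m hs ht hst, mul_add]
  refine variation_le_of_enorm_le m' v (fun B hB => (h B hB).trans ?_) hA
  exact mul_le_mul_right (enorm_le_variation m hB) c

theorem variation_rankOne_ne_top {m : FinAdd Ω (StrongDual ℝ X)}
    (hm : variation m Set.univ ≠ ∞) (z : Z) : variation (rankOne m z) Set.univ ≠ ∞ := by
  refine ((variation_le_mul (m := m) (c := ‖z‖ₑ) (fun A _ => ?_)
    MeasurableSet.univ).trans_lt (ENNReal.mul_lt_top enorm_lt_top hm.lt_top)).ne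
  rw [rankOne_apply, ← ofReal_norm, ContinuousLinearMap.norm_smulRight_apply,
    ENNReal.ofReal_mul (norm_nonneg _), ofReal_norm, ofReal_norm, mul_comm]

theorem semivariation_le_variation (m : FinAdd Ω (X →L[ℝ] Z)) :
    semivariation m ⊤ ≤ variation m Set.univ := by
  refine iSup_le fun P => iSup_le fun x => iSup_le fun hx => ?_
  refine le_trans ?_ ((variation_le_iff m MeasurableSet.univ).1 le_rfl P)
  refine (enorm_sum_le _ _).trans (Finset.sum_le_sum fun B _ => ?_)
  refine ((m B).le_opENorm _).trans (mul_le_of_le_one_right zero_le ?_)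
  rw [← ofReal_norm]
  exact ENNReal.ofReal_le_one.2 (hx B)

theorem integral_rankOne [CompleteSpace Z] {m : FinAdd Ω (StrongDual ℝ X)}
    (hm : variation m Set.univ ≠ ∞) (z : Z) :
    integral (rankOne m z) = (integral m).smulRight z := by
  refine ext_indU fun A c => ?_
  rw [integral_indU (boundedIntegral_of_variation (variation_rankOne_ne_top hm z)),
    ContinuousLinearMap.smulRight_apply, integral_indU (boundedIntegral_of_variation hm)]
  rfl

theorem variation_dualComp_rankOne_le (m : FinAdd Ω (StrongDual ℝ X)) (z : Z)
    (φ : StrongDual ℝ Z) {A : Set Ω} (hA : MeasurableSet A) :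
    variation (dualComp (rankOne m z) φ) A ≤ ‖φ z‖ₑ * variation m A := by
  refine variation_le_mul (fun B _ => ?_) hA
  have : dualComp (rankOne m z) φ B = φ z • m B := by
    ext x
    simp [dualComp_apply, rankOne_apply, mul_comm]
  rw [this, enorm_smul]

theorem isCompactOperator_smulRight {E : Type*} [NormedAddCommGroup E] [NormedSpace ℝ E]
    (ψ : StrongDual ℝ E) (z : Z) : IsCompactOperator (ψ.smulRight z) := by
  have h : IsCompactOperator (ContinuousLinearMap.id ℝ ℝ) := by
    refine ⟨Metric.closedBall 0 1, isCompact_closedBall 0 1, ?_⟩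
    exact Metric.closedBall_mem_nhds 0 one_pos
  have h2 := (h.comp_clm ψ).clm_comp (ContinuousLinearMap.toSpanSingleton ℝ z)
  exact h2

theorem uniformlyAbsCont_of_le {ι : Type*} {ν : ι → Set Ω → ℝ≥0∞} {ν' : Set Ω → ℝ≥0∞}
    {μ : FinAdd Ω ℝ≥0} (h : UniformlyAbsCont (fun _ : Unit => ν') μ)
    (hν : ∀ i A, MeasurableSet A → ν i A ≤ ν' A) : UniformlyAbsCont ν μ := by
  intro ε hε
  obtain ⟨δ, hδ, hA⟩ := h ε hε
  exact ⟨δ, hδ, fun A hAm hμ i => (hν i A hAm).trans_lt (hA A hAm hμ ())⟩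

/-- Tensoring `m` with a vector `z` gives a rank one, hence compact, operator; composing with a
functional `g` such that `g z = 1` recovers `m`. -/
theorem averagesConverge_of_forall_tendsto {Y : Type*} [CompleteSpace X] [NormedAddCommGroup Y]
    [NormedSpace ℝ Y] [CompleteSpace Y] [Nontrivial Y] {μ : FinAdd Ω ℝ≥0}
    (h : ∀ (T : USpace Ω X →L[ℝ] Y) (m : FinAdd Ω (X →L[ℝ] Y)), RepresentsU m T →
      IsCompactOperator T →
      UniformlyAbsCont (fun y : Metric.closedBall (0 : StrongDual ℝ Y) 1 =>
        variation (dualComp m y)) μ →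
      Tendsto (fun π : MPartition Ω => condExpOp μ m π) atBot (𝓝 T))
    {m : FinAdd Ω (StrongDual ℝ X)} (hm : variation m Set.univ ≠ ∞)
    (hac : UniformlyAbsCont (fun _ : Unit => variation m) μ) : AveragesConverge μ m := by
  -- Norm one makes each `|m_y|` of the rank one set function, `‖y‖ ≤ 1`, at most `|m|`, so absolute
  -- continuity is inherited.
  obtain ⟨z, hz⟩ := exists_norm_eq Y zero_le_one
  obtain ⟨g, -, hg⟩ := exists_dual_vector ℝ z (by simp [hz])
  have hgz : g z = 1 := by rw [hg, hz]; simp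
  have hvar := variation_rankOne_ne_top hm z
  have hT := h (integral (rankOne m z)) (rankOne m z)
    ⟨(semivariation_le_variation _).trans_lt hvar.lt_top, fun _ => rfl⟩
    (by rw [integral_rankOne hm]; exact isCompactOperator_smulRight _ _)
    (uniformlyAbsCont_of_le hac fun y A hA => by
      refine (variation_dualComp_rankOne_le m z y hA).trans (mul_le_of_le_one_left zero_le ?_)
      rw [← ofReal_norm]
      refine ENNReal.ofReal_le_one.2 (((y : StrongDual ℝ Y).le_opNorm z).trans ?_)
      rw [hz, mul_one]
      exact mem_closedBall_zero_iff.1 y.2)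
  refine averagesConverge_of_tendsto hm ?_
  have h2 := ((ContinuousLinearMap.compL ℝ (USpace Ω X) Y ℝ g).continuous.tendsto _).comp hT
  have h3 : g.comp (integral (rankOne m z)) = integral m := by
    rw [integral_rankOne hm]
    ext f
    simp [hgz]
  have h4 : ∀ π : MPartition Ω,
      g.comp (condExpOp μ (rankOne m z) π) = (integral m).comp (avg μ π) := fun π => by
    rw [condExpOp_eq_comp_avg μ (boundedIntegral_of_variation hvar),
      ← ContinuousLinearMap.comp_assoc, h3]
  simp only [Function.comp_def, ContinuousLinearMap.compL_apply, h3, h4] at h2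
  exact h2

theorem IsRegular.of_le {H : Type*} [TopologicalSpace H] [T2Space H] [MeasurableSpace H]
    [BorelSpace H] {ν ν₁ ν₂ : Set H → ℝ≥0∞} (h₁ : IsRegular ν₁) (h₂ : IsRegular ν₂)
    (hm₁ : ∀ A B, MeasurableSet A → MeasurableSet B → A ⊆ B → ν₁ A ≤ ν₁ B)
    (hm₂ : ∀ A B, MeasurableSet A → MeasurableSet B → A ⊆ B → ν₂ A ≤ ν₂ B) (C : ℝ≥0)
    (h : ∀ A, MeasurableSet A → ν A ≤ C * (ν₁ A + ν₂ A)) : IsRegular ν := by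
  intro E hE ε hε
  -- Then `ε = (C + 1) * (δ + δ)`; `C + 1` instead of `C` makes the final inequality strict.
  set δ : ℝ≥0 := ε / (2 * (C + 1)) with hδ
  have hδ0 : 0 < δ := by positivity
  obtain ⟨K₁, U₁, hK₁, hU₁, hKE₁, hEU₁, hν₁⟩ := h₁ E hE δ hδ0
  obtain ⟨K₂, U₂, hK₂, hU₂, hKE₂, hEU₂, hν₂⟩ := h₂ E hE δ hδ0
  have hm := fun (K U : Set H) (hK : IsCompact K) (hU : IsOpen U) =>
    hU.measurableSet.diff hK.isClosed.measurableSet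
  refine ⟨K₁ ∪ K₂, U₁ ∩ U₂, hK₁.union hK₂, hU₁.inter hU₂, Set.union_subset hKE₁ hKE₂,
    Set.subset_inter hEU₁ hEU₂, ?_⟩
  have hmm := hm _ _ (hK₁.union hK₂) (hU₁.inter hU₂)
  refine (h _ hmm).trans_lt ?_
  calc (C : ℝ≥0∞) * (ν₁ ((U₁ ∩ U₂) \ (K₁ ∪ K₂)) + ν₂ ((U₁ ∩ U₂) \ (K₁ ∪ K₂)))
      ≤ C * (δ + δ) := by
        gcongr
        · exact (hm₁ _ _ hmm (hm _ _ hK₁ hU₁) (Set.sdiff_subset_sdiff Set.inter_subset_left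
            Set.subset_union_left)).trans hν₁.le
        · exact (hm₂ _ _ hmm (hm _ _ hK₂ hU₂) (Set.sdiff_subset_sdiff Set.inter_subset_right
            Set.subset_union_right)).trans hν₂.le
    _ < ε := by
        rw [← ENNReal.coe_add, ← ENNReal.coe_mul, ENNReal.coe_lt_coe]
        have : ε = (C + 1) * (δ + δ) := by rw [hδ]; field_simp; ring
        rw [this]
        gcongr
        exact lt_add_one C

/-- The hypothesis controls the error only on `C(H, X)`. To bound the variation of the deviation,
that deviation must be regular, which follows from domination by `|m| + C μ`; this is where
regularity of `μ` enters. -/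
theorem averagesConverge_of_forall_tendsto_comp {H Y : Type*} [TopologicalSpace H]
    [CompactSpace H] [T2Space H] [MeasurableSpace H] [BorelSpace H] [CompleteSpace X]
    [NormedAddCommGroup Y] [NormedSpace ℝ Y] [Nontrivial Y] {μ : FinAdd H ℝ≥0}
    (hμ : IsRegular (fun A => (μ A : ℝ≥0∞)))
    (h : ∀ (T : C(H, X) →L[ℝ] Y) (m : FinAdd H (X →L[ℝ] StrongDual ℝ (StrongDual ℝ Y))),
      RepresentsC m T → IsCompactOperator T →
      UniformlyAbsCont (fun y : Metric.closedBall (0 : StrongDual ℝ Y) 1 =>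
        variation (bidualComp m y)) μ →
      Tendsto (fun π : MPartition H => (condExpOp μ m π).comp (contToU H X)) atBot
        (𝓝 ((NormedSpace.inclusionInDoubleDual ℝ Y).comp T)))
    {m : FinAdd H (StrongDual ℝ X)} (hm : variation m Set.univ ≠ ∞)
    (hr : IsRegular (variation m))
    (hac : UniformlyAbsCont (fun _ : Unit => variation m) μ) : AveragesConverge μ m := by
  classical
  obtain ⟨y₀, hy₀⟩ := exists_norm_eq Y zero_le_one
  obtain ⟨g, -, hg⟩ := exists_dual_vector ℝ y₀ (by simp [hy₀])
  have hgy : g y₀ = 1 := by rw [hg, hy₀]; simp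
  let z := NormedSpace.inclusionInDoubleDual ℝ Y y₀
  have hvar := variation_rankOne_ne_top hm z
  have hle : ∀ (y : StrongDual ℝ Y) {A : Set H}, MeasurableSet A →
      variation (bidualComp (rankOne m z) y) A ≤ ‖y y₀‖ₑ * variation m A :=
    fun y A hA => variation_dualComp_rankOne_le m z _ hA
  have hmono : ∀ A B, MeasurableSet A → MeasurableSet B → A ⊆ B → variation m A ≤ variation m B :=
    fun A B _ hB hAB => variation_mono m hB hAB
  have hT := h (((integral m).comp (contToU H X)).smulRight y₀) (rankOne m z)
    ⟨(semivariation_le_variation _).trans_lt hvar.lt_top, fun y =>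
      hr.of_le hr hmono hmono ‖y y₀‖₊ fun A hA => (hle y hA).trans (by
        rw [enorm_eq_nnnorm]; gcongr; exact le_self_add), fun f => by
      rw [integral_rankOne hm]
      simp [z]⟩
    (isCompactOperator_smulRight _ _)
    (uniformlyAbsCont_of_le hac fun y A hA => by
      refine (hle y hA).trans (mul_le_of_le_one_left zero_le ?_)
      rw [← ofReal_norm]
      refine ENNReal.ofReal_le_one.2 (((y : StrongDual ℝ Y).le_opNorm y₀).trans ?_)
      rw [hy₀, mul_one]
      exact mem_closedBall_zero_iff.1 y.2)
  let G := NormedSpace.inclusionInDoubleDual ℝ (StrongDual ℝ Y) g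
  have h2 := ((ContinuousLinearMap.compL ℝ (C(H, X)) _ ℝ G).continuous.tendsto _).comp hT
  have h3 : G.comp (integral (rankOne m z)) = integral m := by
    rw [integral_rankOne hm]
    ext f
    simp [G, z, hgy]
  have h4 : ∀ π : MPartition H, G.comp ((condExpOp μ (rankOne m z) π).comp (contToU H X)) =
      ((integral m).comp (avg μ π)).comp (contToU H X) := fun π => by
    rw [condExpOp_eq_comp_avg μ (boundedIntegral_of_variation hvar), ← h3]
    rfl
  have h5 : G.comp ((NormedSpace.inclusionInDoubleDual ℝ Y).comp
      (((integral m).comp (contToU H X)).smulRight y₀)) = (integral m).comp (contToU H X) := by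
    ext f
    simp [G, hgy]
  simp only [Function.comp_def, ContinuousLinearMap.compL_apply, h4, h5] at h2
  intro ε hε
  obtain ⟨π, hπ⟩ := ((Metric.tendsto_nhds.1 h2) ε (by exact_mod_cast hε)).exists
  have hdev := variation_deviation_ne_top μ hm π
  obtain ⟨C, hC⟩ := exists_variation_deviation_le μ m π
  have hreg : IsRegular (variation (deviation μ m π)) :=
    hr.of_le hμ hmono (fun A B hA hB hAB => by
      exact_mod_cast FinAdd.mono_nnreal μ hA hB hAB) (1 + C) fun A hA => (hC A hA).trans (by
        rw [ENNReal.coe_add, ENNReal.coe_one, mul_add, add_mul, add_mul, one_mul, one_mul]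
        exact add_le_add le_self_add le_add_self)
  refine ⟨π, (variation_le_norm_integral (boundedIntegral_of_variation hdev)).trans ?_⟩
  refine (ENNReal.ofReal_le_ofReal (opNorm_integral_le_of_isRegular hdev hreg)).trans ?_
  rw [integral_deviation μ hm, ContinuousLinearMap.sub_comp, ← dist_eq_norm, dist_comm]
  exact ENNReal.ofReal_le_of_le_toReal (by simpa using hπ.le)

end RankOne

/-! ### Densities from convergent averages -/

section Density

variable {Ω Z : Type*} [MeasurableSpace Ω] [NormedAddCommGroup Z] [NormedSpace ℝ Z]

/-- A finite measure as a finitely additive set function. -/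
def ofMeasure (μ : Measure Ω) [IsFiniteMeasure μ] : FinAdd Ω ℝ≥0 :=
  FinAdd.ofUnion (fun A => (μ A).toNNReal) (by simp) fun hs ht hst => by
    rw [measure_union hst ht, ENNReal.toNNReal_add (measure_ne_top μ _) (measure_ne_top μ _)]

theorem coe_ofMeasure (μ : Measure Ω) [IsFiniteMeasure μ] (A : Set Ω) :
    (ofMeasure μ A : ℝ≥0∞) = μ A :=
  ENNReal.coe_toNNReal (measure_ne_top μ A)

/-- A vector measure as a finitely additive set function. -/
def ofVectorMeasure {Z : Type*} [NormedAddCommGroup Z] (G : VectorMeasure Ω Z) : FinAdd Ω Z :=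
  FinAdd.ofUnion (fun A => G A) (by simp) fun hs ht hst => G.of_union hst hs ht

theorem ofVectorMeasure_apply {Z : Type*} [NormedAddCommGroup Z] (G : VectorMeasure Ω Z)
    (A : Set Ω) : ofVectorMeasure G A = G A := rfl

theorem variation_ofVectorMeasure {Z : Type*} [NormedAddCommGroup Z] (G : VectorMeasure Ω Z)
    {A : Set Ω} (hA : MeasurableSet A) : variation (ofVectorMeasure G) A = G.variation A := by
  rw [VectorMeasure.variation_apply, preVariation_apply, VectorMeasure.ennrealToMeasure_apply hA]
  rfl

/-- Vanishing on null sets becomes an `ε`-`δ` condition because the variation is a finite measure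
with an integrable density with respect to `μ`. -/
theorem uniformlyAbsCont_ofVectorMeasure {Z : Type*} [NormedAddCommGroup Z]
    {G : VectorMeasure Ω Z} {μ : Measure Ω} [IsFiniteMeasure μ] (hG : G.variation Set.univ < ∞)
    (hac : G ≪ᵥ μ.toENNRealVectorMeasure) :
    UniformlyAbsCont (fun _ : Unit => variation (ofVectorMeasure G)) (ofMeasure μ) := by
  have : IsFiniteMeasure G.variation := ⟨hG⟩
  have hac' : G.variation ≪ μ := by
    refine Measure.AbsolutelyContinuous.mk fun s hs h0 => ?_
    rw [VectorMeasure.variation_apply_eq_zero hs]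
    intro t hts ht
    refine hac ?_
    rw [Measure.toENNRealVectorMeasure_apply_measurable ht]
    exact measure_mono_null hts h0
  intro ε hε
  obtain ⟨δ, hδ, h⟩ := exists_pos_setLIntegral_lt_of_measure_lt
    (Measure.lintegral_rnDeriv_lt_top G.variation μ).ne (ε := (ε : ℝ≥0∞)) (by simpa using hε.ne')
  obtain ⟨δ', hδ', hδδ'⟩ := ENNReal.lt_iff_exists_nnreal_btwn.1 hδ
  refine ⟨δ', by simpa using hδ', fun A hA hμ _ => ?_⟩
  change variation (ofVectorMeasure G) A < ε
  rw [variation_ofVectorMeasure G hA, ← Measure.setLIntegral_rnDeriv hac' A]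
  refine h A (lt_trans ?_ hδδ')
  rw [← coe_ofMeasure]
  exact_mod_cast hμ

/-- The step function with value `G(A) / μ(A)` on the members `A` of the partition. -/
def stepFun (μ : FinAdd Ω ℝ≥0) (G : FinAdd Ω Z) (π : MPartition Ω) (ω : Ω) : Z :=
  ∑ A ∈ π.parts, (A : Set Ω).indicator (fun _ => (μ A)⁻¹ • G A) ω

theorem integrable_stepFun (ν : Measure Ω) [IsFiniteMeasure ν] (μ : FinAdd Ω ℝ≥0)
    (G : FinAdd Ω Z) (π : MPartition Ω) : Integrable (stepFun μ G π) ν :=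
  integrable_finsetSum _ fun A _ => (integrable_const _).indicator A.2

theorem setIntegral_stepFun [CompleteSpace Z] (μ : Measure Ω) [IsFiniteMeasure μ]
    (G : FinAdd Ω Z) (π : MPartition Ω) (B : Set Ω) :
    ∫ ω in B, stepFun (ofMeasure μ) G π ω ∂μ = G B - deviation (ofMeasure μ) G π B := by
  rw [deviation_apply, sub_sub_cancel]
  simp only [stepFun]
  rw [integral_finsetSum _ fun A _ => ((integrable_const _).indicator A.2)]
  refine Finset.sum_congr rfl fun A _ => ?_
  rw [integral_indicator A.2, setIntegral_const, Measure.real, Measure.restrict_apply A.2]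
  change (ofMeasure μ ((A : Set Ω) ∩ B) : ℝ) • _ = _
  simp only [NNReal.smul_def, smul_smul, NNReal.coe_mul, mul_comm]

/-- The `L¹` norm is the total variation of the measure with this density, and that measure is the
difference of two deviations of `G`. -/
theorem lintegral_stepFun_sub_le [CompleteSpace Z] (μ : Measure Ω) [IsFiniteMeasure μ]
    (G : FinAdd Ω Z) (π π' : MPartition Ω) :
    ∫⁻ ω, ‖stepFun (ofMeasure μ) G π ω - stepFun (ofMeasure μ) G π' ω‖ₑ ∂μ ≤
      variation (deviation (ofMeasure μ) G π) Set.univ +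
        variation (deviation (ofMeasure μ) G π') Set.univ := by
  have hi := integrable_stepFun μ (ofMeasure μ) G π
  have hi' := integrable_stepFun μ (ofMeasure μ) G π'
  have h1 := Measure.variation_withDensityᵥ (hi.sub hi')
  have h2 := congrArg (fun ν : Measure Ω => ν Set.univ) h1
  simp only [withDensity_apply _ MeasurableSet.univ, Measure.restrict_univ, Pi.sub_apply] at h2
  rw [← h2, ← variation_ofVectorMeasure _ MeasurableSet.univ]
  let v : FinAdd Ω ℝ≥0∞ := FinAdd.ofUnion (fun B => variation (deviation (ofMeasure μ) G π) B +
      variation (deviation (ofMeasure μ) G π') B) (by simp [variation, preVariation.empty])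
    fun hs ht hst => by
      rw [variation_union _ hs ht hst, variation_union _ hs ht hst, add_add_add_comm]
  refine variation_le_of_enorm_le _ v (fun B hB => ?_) MeasurableSet.univ
  rw [ofVectorMeasure_apply, withDensityᵥ_apply (hi.sub hi') hB]
  simp only [Pi.sub_apply]
  rw [integral_sub hi.integrableOn hi'.integrableOn, setIntegral_stepFun μ G π B,
    setIntegral_stepFun μ G π' B, sub_sub_sub_cancel_left]
  refine enorm_sub_le.trans ?_
  rw [add_comm]
  exact add_le_add (enorm_le_variation _ hB) (enorm_le_variation _ hB)

/-- If the averages of `G` with respect to a finite measure `μ` converge, then `G` has a density. -/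
theorem exists_density_of_averagesConverge [CompleteSpace Z] (μ : Measure Ω) [IsFiniteMeasure μ]
    {G : FinAdd Ω Z} (h : AveragesConverge (ofMeasure μ) G) :
    ∃ g : Ω → Z, Integrable g μ ∧ ∀ E : Set Ω, MeasurableSet E → G E = ∫ ω in E, g ω ∂μ := by
  have hb : ∀ n : ℕ, (0 : ℝ≥0) < 1 / ((n : ℝ≥0) + 1) := fun n => by positivity
  choose π hπ using fun n : ℕ => h (1 / ((n : ℝ≥0) + 1)) (hb n)
  have hb0 : Tendsto (fun n : ℕ => ((1 / ((n : ℝ≥0) + 1) : ℝ≥0) : ℝ)) atTop (𝓝 0) := by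
    simpa using tendsto_one_div_add_atTop_nhds_zero_nat (𝕜 := ℝ)
  have hmono : ∀ n N : ℕ, N ≤ n → (1 / ((n : ℝ≥0) + 1) : ℝ≥0) ≤ 1 / ((N : ℝ≥0) + 1) :=
    fun n N hn => by gcongr
  have hi := fun n => integrable_stepFun μ (ofMeasure μ) G (π n)
  let f : ℕ → Ω →₁[μ] Z := fun n => (hi n).toL1 _
  have hf : CauchySeq f := by
    refine cauchySeq_of_le_tendsto_0 (fun N : ℕ => 2 * ((1 / ((N : ℝ≥0) + 1) : ℝ≥0) : ℝ)) ?_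
      (by simpa using hb0.const_mul 2)
    intro n k N hn hk
    rw [dist_edist]
    refine ENNReal.toReal_le_of_le_ofReal (by positivity) ?_
    rw [Integrable.edist_toL1_toL1]
    simp only [edist_eq_enorm_sub]
    refine (lintegral_stepFun_sub_le μ G (π n) (π k)).trans
      ((add_le_add ((hπ n).trans (ENNReal.coe_le_coe.2 (hmono n N hn)))
        ((hπ k).trans (ENNReal.coe_le_coe.2 (hmono k N hk)))).trans_eq ?_)
    rw [two_mul, ENNReal.ofReal_add (NNReal.coe_nonneg _) (NNReal.coe_nonneg _),
      ENNReal.ofReal_coe_nnreal]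
  obtain ⟨g, hg⟩ := cauchySeq_tendsto_of_complete hf
  refine ⟨g, L1.integrable_coeFn g, fun E hE => ?_⟩
  have h1 := ((continuous_setIntegral (X := Ω) (μ := μ) (E := Z) E).tendsto g).comp hg
  have h2 : ∀ n, ∫ ω in E, f n ω ∂μ = G E - deviation (ofMeasure μ) G (π n) E := fun n => by
    rw [← setIntegral_stepFun μ G (π n) E]
    exact integral_congr_ae (ae_restrict_of_ae (hi n).coeFn_toL1)
  have h3 : Tendsto (fun n => ∫ ω in E, f n ω ∂μ) atTop (𝓝 (G E)) := by
    rw [tendsto_iff_norm_sub_tendsto_zero]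
    refine squeeze_zero (fun _ => norm_nonneg _) (fun n => ?_) hb0
    rw [h2, sub_sub_cancel_left, norm_neg]
    have h4 : ‖deviation (ofMeasure μ) G (π n) E‖ₑ ≤ ((1 / ((n : ℝ≥0) + 1) : ℝ≥0) : ℝ≥0∞) :=
      (enorm_le_variation _ hE).trans
        ((variation_mono _ MeasurableSet.univ (Set.subset_univ E)).trans (hπ n))
    have h5 := ENNReal.toReal_mono ENNReal.coe_ne_top h4
    rwa [toReal_enorm, ENNReal.coe_toReal] at h5
  exact tendsto_nhds_unique h3 h1

end Density

/-! ### Contents on the clopen sets of a Boolean space -/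

section Clopen

variable {K : Type*} [TopologicalSpace K] [CompactSpace K] [T2Space K] [TotallyDisconnectedSpace K]
  [SecondCountableTopology K] [MeasurableSpace K] [BorelSpace K]

theorem isSetRing_isClopen {K : Type*} [TopologicalSpace K] :
    IsSetRing {S : Set K | IsClopen S} where
  empty_mem := isClopen_empty
  union_mem _ _ hs ht := IsClopen.union hs ht
  sdiff_mem _ _ hs ht := IsClopen.diff hs ht

theorem measurableSpace_eq_generateFrom_isClopen :
    ‹MeasurableSpace K› = MeasurableSpace.generateFrom {S : Set K | IsClopen S} := by
  rw [BorelSpace.measurable_eq (α := K)]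
  exact isTopologicalBasis_isClopen.borel_eq_generateFrom

/-- Contents on the clopen sets extend to measures. -/
theorem exists_measure_eq_content (v : AddContent ℝ≥0∞ {S : Set K | IsClopen S}) :
    ∃ ν : Measure K, ∀ S, IsClopen S → ν S = v S := by
  -- A countable union of clopen sets that is itself clopen is compact, so finitely many members
  -- cover it.
  have hsub : v.IsSigmaSubadditive := by
    intro f hf hfU
    obtain ⟨t, ht⟩ := (hfU : IsClopen _).1.isCompact.elim_finite_subcover f
      (fun i => (hf i).2) le_rfl
    have : ⋃ i, f i = ⋃ i ∈ t, f i := ht.antisymm (Set.iUnion₂_subset_iUnion _ _)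
    rw [this]
    exact (addContent_biUnion_le isSetRing_isClopen fun i _ => hf i).trans (ENNReal.sum_le_tsum t)
  exact ⟨v.measure isSetRing_isClopen.isSetSemiring
      measurableSpace_eq_generateFrom_isClopen.le hsub,
    fun S hS => v.measure_eq isSetRing_isClopen.isSetSemiring
      measurableSpace_eq_generateFrom_isClopen hsub hS⟩

/-- The image on the clopen sets of `K` of a finitely additive set function under a map to `K`. -/
def clopenContent {Ω M K : Type*} [MeasurableSpace Ω] [AddCommMonoid M] [TopologicalSpace K]
    (m : FinAdd Ω M) (φ : Ω → K) (hφ : ∀ S, IsClopen S → MeasurableSet (φ ⁻¹' S)) :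
    AddContent M {S : Set K | IsClopen S} :=
  isSetRing_isClopen.addContent_of_union (fun S => m (φ ⁻¹' S)) (by simp) fun hs ht hst => by
    rw [Set.preimage_union, FinAdd.union m (hφ _ hs) (hφ _ ht) (hst.preimage φ)]

/-- A pair of finitely additive set functions with `m ≪ μ` and `m` of bounded variation is carried
by every map to a Boolean space to a pair of countably additive ones. -/
theorem exists_vectorMeasure_eq_content {Ω Z : Type*} [MeasurableSpace Ω] [NormedAddCommGroup Z]
    [CompleteSpace Z] {μ : FinAdd Ω ℝ≥0} {m : FinAdd Ω Z}
    (hm : variation m Set.univ ≠ ∞) (hac : UniformlyAbsCont (fun _ : Unit => variation m) μ)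
    (φ : Ω → K) (hφ : ∀ S, IsClopen S → MeasurableSet (φ ⁻¹' S)) :
    ∃ (ν : Measure K) (G : VectorMeasure K Z), (∀ S, IsClopen S → ν S = μ (φ ⁻¹' S)) ∧
      (∀ S, IsClopen S → G S = m (φ ⁻¹' S)) ∧ G.variation Set.univ < ∞ ∧
      G ≪ᵥ ν.toENNRealVectorMeasure := by
  obtain ⟨ν, hν⟩ := exists_measure_eq_content (clopenContent (coeContent μ) φ hφ)
  obtain ⟨ρ, hρ⟩ := exists_measure_eq_content (clopenContent (variationContent m) φ hφ)
  have hν' : ∀ S, IsClopen S → ν S = μ (φ ⁻¹' S) := hν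
  have hρ' : ∀ S, IsClopen S → ρ S = variation m (φ ⁻¹' S) := hρ
  have : IsFiniteMeasure ν := ⟨by rw [hν' _ isClopen_univ]; exact ENNReal.coe_lt_top⟩
  have : IsFiniteMeasure ρ := ⟨by rw [hρ' _ isClopen_univ]; exact hm.lt_top⟩
  obtain ⟨G, hG, hGρ⟩ :=
    VectorMeasure.exists_extension_of_isSetSemiring_of_le_measure_of_generateFrom
    (μ := ρ) (m := clopenContent m φ hφ) isSetRing_isClopen.isSetSemiring
    (fun S hS => by rw [hρ' S hS]; exact enorm_le_variation m (hφ S hS))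
    measurableSpace_eq_generateFrom_isClopen
  refine ⟨ν, G, hν', hG, ?_, ?_⟩
  · exact ((VectorMeasure.variation_le_of_forall_enorm_le fun E _ => hGρ E) Set.univ).trans_lt
      (measure_lt_top ρ _)
  · intro E hE
    by_cases hEm : MeasurableSet E
    swap
    · exact G.not_measurable hEm
    rw [Measure.toENNRealVectorMeasure_apply_measurable hEm] at hE
    suffices h : ρ E = 0 by simpa [h] using hGρ E
    refine le_antisymm (ENNReal.le_of_forall_pos_le_add fun ε hε _ => ?_) zero_le
    obtain ⟨δ, hδ, hδε⟩ := hac (ε / 2) (by positivity)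
    -- Absolute continuity is known only on clopen sets: approximate the `ν`-null set `E` by a
    -- clopen `S` for `ρ` and `ν` at once. Then `ν S < δ` forces `ρ S < ε / 2`.
    obtain ⟨S, hS, hSE⟩ := exists_measure_symmDiff_lt_of_generateFrom_isSetRing (μ := ρ + ν)
      isSetRing_isClopen ⟨{Set.univ}, by simp, by simpa using isClopen_univ, by simp⟩
      measurableSpace_eq_generateFrom_isClopen hEm
      (ε := min ((ε / 2 : ℝ≥0) : ℝ≥0∞) δ) (by
        refine lt_min ?_ (by exact_mod_cast hδ)
        exact_mod_cast (by positivity : 0 < ε / 2))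
    rw [Measure.add_apply] at hSE
    have hS' : IsClopen S := hS
    have h1 : ν S < δ := by
      calc ν S ≤ ν (symmDiff S E) + ν E := by
            refine (measure_mono ?_).trans (measure_union_le _ _)
            intro x hx
            by_cases hxE : x ∈ E
            · exact Or.inr hxE
            · exact Or.inl (Or.inl ⟨hx, hxE⟩)
        _ = ν (symmDiff S E) := by rw [hE, add_zero]
        _ < δ := (le_add_self.trans_lt hSE).trans_le (min_le_right _ _)
    have h2 : ρ S < (ε / 2 : ℝ≥0) := by
      rw [hρ' S hS']
      rw [hν' S hS', ENNReal.coe_lt_coe] at h1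
      exact hδε _ (hφ S hS') h1 ()
    have h3 : ρ (symmDiff S E) < (ε / 2 : ℝ≥0) :=
      (le_self_add.trans_lt hSE).trans_le (min_le_left _ _)
    rw [zero_add]
    calc ρ E ≤ ρ (symmDiff S E) + ρ S := by
          refine (measure_mono ?_).trans (measure_union_le _ _)
          intro x hx
          by_cases hxS : x ∈ S
          · exact Or.inr hxS
          · exact Or.inl (Or.inr ⟨hx, hxS⟩)
      _ ≤ (ε / 2 : ℝ≥0) + (ε / 2 : ℝ≥0) := add_le_add h3.le h2.le
      _ = ε := by rw [← ENNReal.coe_add, add_halves]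

end Clopen

/-! ### Averages of set functions with a density on a Boolean space -/

section Lift

/-- Estimate of the averages of `m` over `π` when `m` and `μ` have countably additive images on a
Boolean space, with density `g`, and `g` is close to a function that is almost constant on the sets
corresponding to the members of `π`. -/
theorem sum_enorm_deviation_le {Ω K Z : Type*} [MeasurableSpace Ω] [NormedAddCommGroup Z]
    [NormedSpace ℝ Z] [CompleteSpace Z] [TopologicalSpace K] [MeasurableSpace K]
    [OpensMeasurableSpace K] {μ : FinAdd Ω ℝ≥0} {m : FinAdd Ω Z} {φ : Ω → K} {ν : Measure K}
    [IsFiniteMeasure ν] {g h : K → Z} (hg : Integrable g ν)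
    (hν : ∀ S, IsClopen S → ν S = μ (φ ⁻¹' S))
    (hG : ∀ S, IsClopen S → m (φ ⁻¹' S) = ∫ x in S, g x ∂ν) {π q : MPartition Ω}
    {L : MSet Ω → Set K} (hL : ∀ A, IsClopen (L A))
    (hLπ : ∀ A ∈ π.parts, φ ⁻¹' L A = A) (hLq : ∀ B ∈ q.parts, φ ⁻¹' L B = B) {η : ℝ≥0}
    (hη : ∀ A ∈ π.parts, ∃ c : Z, ∀ᵐ x ∂ν.restrict (L A), ‖h x - c‖ₑ ≤ η) :
    ∑ B ∈ q.parts, ‖deviation μ m π B‖ₑ ≤ 2 * (∫⁻ x, ‖g x - h x‖ₑ ∂ν + η * ν Set.univ) := by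
  -- On `L A` the density of `τ` dominates `‖g - c A‖`, so `τ` bounds the error of treating `g` as
  -- constant there.
  set τ : Measure K := ν.withDensity fun x => ‖g x - h x‖ₑ + η with hτ
  have hLm : ∀ A, MeasurableSet (L A) := fun A => (hL A).isOpen.measurableSet
  have hτu : τ Set.univ = ∫⁻ x, ‖g x - h x‖ₑ ∂ν + η * ν Set.univ := by
    rw [hτ, withDensity_apply _ MeasurableSet.univ, Measure.restrict_univ,
      lintegral_add_right _ measurable_const, lintegral_const]
  -- Only the preimages of the sets `L A` are disjoint, so these sets are disjoint merely up to null
  -- sets.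
  have hdisj : ∀ p : MPartition Ω, (∀ A ∈ p.parts, φ ⁻¹' L A = A) →
      (p.parts : Set (MSet Ω)).Pairwise (Function.onFun (AEDisjoint τ) L) := by
    intro p hp A hA B hB hAB
    refine withDensity_absolutelyContinuous ν _ ?_
    rw [hν _ ((hL A).inter (hL B)), Set.preimage_inter, hp A hA, hp B hB,
      (p.pairwiseDisjoint hA hB hAB).inter_eq]
    simp
  have hsum : ∀ p : MPartition Ω, (∀ A ∈ p.parts, φ ⁻¹' L A = A) → ∀ S : Set K, MeasurableSet S →
      ∑ A ∈ p.parts, τ (S ∩ L A) ≤ τ S := by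
    intro p hp S hS
    rw [← measure_biUnion_finset₀ ((hdisj p hp).imp_on fun A _ B _ _ hAB => ?_)
      fun A _ => (hS.inter (hLm A)).nullMeasurableSet]
    · exact measure_mono (Set.iUnion₂_subset fun A _ => Set.inter_subset_left)
    · exact hAB.mono Set.inter_subset_right Set.inter_subset_right
  choose! c hc using hη
  have hbound : ∀ A ∈ π.parts, ∀ S, IsClopen S → S ⊆ L A →
      ‖m (φ ⁻¹' S) - μ (φ ⁻¹' S) • c A‖ₑ ≤ τ S := by
    intro A hA S hS hSA
    have h1 : m (φ ⁻¹' S) - μ (φ ⁻¹' S) • c A = ∫ x in S, (g x - c A) ∂ν := by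
      rw [integral_sub hg.integrableOn (integrable_const _), hG S hS, setIntegral_const,
        Measure.real, hν S hS, ENNReal.coe_toReal, NNReal.smul_def]
    rw [h1, hτ, withDensity_apply _ hS.isOpen.measurableSet]
    refine (enorm_integral_le_lintegral_enorm _).trans (lintegral_mono_ae ?_)
    filter_upwards [ae_restrict_of_ae_restrict_of_subset hSA (hc A hA)] with x hx
    rw [← sub_add_sub_cancel (g x) (h x) (c A)]
    exact (enorm_add_le _ _).trans (add_le_add_right hx _)
  have hterm : ∀ B ∈ q.parts, ‖deviation μ m π B‖ₑ ≤ ∑ A ∈ π.parts, (τ (L A ∩ L B) +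
      ((μ A)⁻¹ * μ ((A : Set Ω) ∩ B) : ℝ≥0) * τ (L A)) := by
    intro B hB
    -- Averaging reproduces multiples of `μ` that are constant on each part, so the constants `c A`
    -- can be subtracted from both terms.
    have h1 : deviation μ m π B = ∑ A ∈ π.parts,
        ((m ((A : Set Ω) ∩ B) - μ ((A : Set Ω) ∩ B) • c A) -
          ((μ A)⁻¹ * μ ((A : Set Ω) ∩ B)) • (m A - μ A • c A)) := by
      rw [deviation_apply, ← π.sum_inter m B.2, ← Finset.sum_sub_distrib]
      refine Finset.sum_congr rfl fun A _ => ?_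
      have h2 : ((μ A)⁻¹ * μ ((A : Set Ω) ∩ B)) • μ A • c A = μ ((A : Set Ω) ∩ B) • c A := by
        rw [smul_smul, mul_comm, inv_mul_self_mul_inter]
      rw [smul_sub, h2]
      abel
    rw [h1]
    refine (enorm_sum_le _ _).trans (Finset.sum_le_sum fun A hA => ?_)
    refine enorm_sub_le.trans (add_le_add ?_ ?_)
    · have := hbound A hA (L A ∩ L B) ((hL A).inter (hL B)) Set.inter_subset_left
      rwa [Set.preimage_inter, hLπ A hA, hLq B hB] at this
    · have := hbound A hA (L A) (hL A) le_rfl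
      rw [hLπ A hA] at this
      rw [NNReal.smul_def, enorm_smul, Real.enorm_of_nonneg (NNReal.coe_nonneg _),
        ENNReal.ofReal_coe_nnreal]
      gcongr
  calc ∑ B ∈ q.parts, ‖deviation μ m π B‖ₑ
      ≤ ∑ B ∈ q.parts, ∑ A ∈ π.parts, (τ (L A ∩ L B) +
          ((μ A)⁻¹ * μ ((A : Set Ω) ∩ B) : ℝ≥0) * τ (L A)) := Finset.sum_le_sum hterm
    _ = ∑ A ∈ π.parts, (∑ B ∈ q.parts, τ (L A ∩ L B) +
          (∑ B ∈ q.parts, (((μ A)⁻¹ * μ ((A : Set Ω) ∩ B) : ℝ≥0) : ℝ≥0∞)) * τ (L A)) := by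
        rw [Finset.sum_comm]
        simp_rw [Finset.sum_add_distrib, Finset.sum_mul]
    -- The factor `2` arises here: once from `m` on the pieces `A ∩ B`, once from its averages,
    -- whose weights sum to at most `1`.
    _ ≤ ∑ A ∈ π.parts, (τ (L A) + 1 * τ (L A)) := by
        refine Finset.sum_le_sum fun A _ => ?_
        gcongr
        · exact hsum q hLq (L A) (hLm A)
        · rw [← ENNReal.ofNNReal_finsetSum, ← Finset.mul_sum]
          have h1 : ∑ B ∈ q.parts, μ ((A : Set Ω) ∩ B) = μ A := by
            simp_rw [Set.inter_comm (A : Set Ω)]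
            exact q.sum_inter μ A.2
          rw [h1]
          exact_mod_cast inv_mul_le_one
    _ = 2 * ∑ A ∈ π.parts, τ (Set.univ ∩ L A) := by
        simp_rw [one_mul, ← two_mul, ← Finset.mul_sum, Set.univ_inter]
    _ ≤ _ := by
        rw [← hτu]
        gcongr
        exact hsum π hLπ Set.univ MeasurableSet.univ

end Lift

/-! ### Reduction to the Cantor space -/

section Cantor

/-- By compactness `h` is uniformly continuous, and points sharing their first `N` coordinates are
within `(1 / 2) ^ N`. -/
theorem exists_forall_dist_le_of_continuous {K Z : Type*} [TopologicalSpace K]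
    [PseudoMetricSpace Z] (e : K ≃ₜ (ℕ → Bool)) {h : K → Z} (hh : Continuous h) {η : ℝ}
    (hη : 0 < η) : ∃ N : ℕ, ∀ x y, (∀ i < N, e x i = e y i) → dist (h x) (h y) ≤ η := by
  let I : MetricSpace (ℕ → Bool) := PiNat.metricSpace
  have hu := @CompactSpace.uniformContinuous_of_continuous (ℕ → Bool) Z
    I.toPseudoMetricSpace.toUniformSpace _ _ (h ∘ e.symm) (hh.comp e.symm.continuous)
  obtain ⟨δ, hδ, hd⟩ := Metric.uniformContinuous_iff.1 hu η hη
  obtain ⟨N, hN⟩ := exists_pow_lt_of_lt_one hδ (one_half_lt_one (α := ℝ))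
  refine ⟨N, fun x y hxy => ?_⟩
  have h1 : dist (e x) (e y) ≤ (1 / 2) ^ N :=
    PiNat.mem_cylinder_iff_dist_le.1 (PiNat.mem_cylinder_iff.2 hxy)
  simpa using (hd (h1.trans_lt hN)).le

/-- If every countably additive `Z`-valued set function of bounded variation on the Cantor space
has densities, then the averages of every finitely additive set function `m ≪ μ` of bounded
variation converge. -/
theorem averagesConverge_of_cantor {Ω K Z : Type*} [MeasurableSpace Ω] [NormedAddCommGroup Z]
    [NormedSpace ℝ Z] [CompleteSpace Z] [TopologicalSpace K] [CompactSpace K] [T2Space K]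
    [TotallyDisconnectedSpace K] [SecondCountableTopology K] [MeasurableSpace K] [BorelSpace K]
    (e : K ≃ₜ (ℕ → Bool))
    (hK : ∀ (ν : Measure K) [IsFiniteMeasure ν] (G : VectorMeasure K Z),
      G.variation Set.univ < ∞ → G ≪ᵥ ν.toENNRealVectorMeasure →
      ∃ g : K → Z, Integrable g ν ∧ ∀ E : Set K, MeasurableSet E → G E = ∫ x in E, g x ∂ν)
    {μ : FinAdd Ω ℝ≥0} {m : FinAdd Ω Z} (hm : variation m Set.univ ≠ ∞)
    (hac : UniformlyAbsCont (fun _ : Unit => variation m) μ) : AveragesConverge μ m := by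
  classical
  by_contra hcon
  simp only [AveragesConverge, not_forall, not_exists, not_le] at hcon
  obtain ⟨ε, hε, hbad⟩ := hcon
  -- `q π` witnesses that the deviation at `π` has total variation greater than `ε`.
  choose q hq using fun π => preVariation.exists_Finpartition_sum_gt _ MeasurableSet.univ (hbad π)
  let p : ℕ → MPartition Ω := fun n => Nat.rec (Classical.arbitrary _) (fun _ π => π ⊓ q π) n
  have hp_succ : ∀ n, p (n + 1) = p n ⊓ q (p n) := fun n => rfl
  have hp_anti : Antitone p := antitone_nat_of_succ_le fun n => inf_le_left
  -- Including `⊥` keeps the family nonempty, so that a sequence can enumerate it.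
  let 𝒮 : Set (MSet Ω) := {⊥} ∪ ⋃ n, (((p n).parts : Set (MSet Ω)) ∪ (q (p n)).parts)
  have h𝒮 : 𝒮.Countable := (Set.countable_singleton _).union
    (Set.countable_iUnion fun n => (Finset.countable_toSet _).union (Finset.countable_toSet _))
  obtain ⟨a, ha⟩ := h𝒮.exists_eq_range ⟨⊥, Or.inl rfl⟩
  -- Each set of the family is eventually decided: every part of a late `p k` lies inside it or
  -- misses it.
  have hdec : ∀ i, ∃ n, ∀ k ≥ n, ∀ C ∈ (p k).parts, ∀ ω ∈ (C : Set Ω), ∀ ω' ∈ (C : Set Ω),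
      (ω ∈ (a i : Set Ω) ↔ ω' ∈ (a i : Set Ω)) := by
    have aux : ∀ (σ : MPartition Ω) (k : ℕ), p k ≤ σ → ∀ A ∈ σ.parts, ∀ C ∈ (p k).parts,
        ∀ ω ∈ (C : Set Ω), ∀ ω' ∈ (C : Set Ω), ω ∈ (A : Set Ω) → ω' ∈ (A : Set Ω) := by
      intro σ k hσ A hA C hC ω hω ω' hω' hωA
      obtain ⟨D, hD, hCD⟩ := hσ hC
      obtain rfl := σ.eq_of_mem hD hA (hCD hω) hωA
      exact hCD hω'
    intro i
    have hi : a i ∈ 𝒮 := ha ▸ Set.mem_range_self i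
    rcases hi with hi | hi
    · refine ⟨0, fun k _ C _ ω _ ω' _ => ?_⟩
      rw [Set.mem_singleton_iff.1 hi]
      exact Iff.rfl
    · obtain ⟨n, hn | hn⟩ := Set.mem_iUnion.1 hi
      · exact ⟨n, fun k hk C hC ω hω ω' hω' =>
          ⟨aux _ k (hp_anti hk) _ hn C hC ω hω ω' hω', aux _ k (hp_anti hk) _ hn C hC ω' hω' ω hω⟩⟩
      · have hle : ∀ k ≥ n + 1, p k ≤ q (p n) := fun k hk =>
          (hp_anti hk).trans ((hp_succ n).le.trans inf_le_right)
        exact ⟨n + 1, fun k hk C hC ω hω ω' hω' =>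
          ⟨aux _ k (hle k hk) _ hn C hC ω hω ω' hω', aux _ k (hle k hk) _ hn C hC ω' hω' ω hω⟩⟩
  choose n hn using hdec
  let φ : Ω → K := fun ω => e.symm fun i => decide (ω ∈ (a i : Set Ω))
  have hφ_apply : ∀ ω i, e (φ ω) i = true ↔ ω ∈ (a i : Set Ω) := fun ω i => by simp [φ]
  have hφ_meas : Measurable φ := by
    refine e.symm.continuous.measurable.comp (measurable_pi_lambda _ fun i => ?_)
    refine measurable_to_bool ?_
    convert (a i).2 using 1
    ext ω
    simp
  have hφ : ∀ S, IsClopen S → MeasurableSet (φ ⁻¹' S) := fun S hS =>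
    hφ_meas hS.isOpen.measurableSet
  obtain ⟨ν, G, hν, hG, hGv, hGac⟩ := exists_vectorMeasure_eq_content hm hac φ hφ
  have : IsFiniteMeasure ν := ⟨by rw [hν _ isClopen_univ]; exact ENNReal.coe_lt_top⟩
  obtain ⟨g, hg, hgG⟩ := hK ν G hGv hGac
  -- Chosen so that `η * μ Ω ≤ ε / 4`; with the `L¹` error `ε / 4` and the factor `2`, the total is
  -- at most `ε`.
  set η : ℝ≥0 := ε / (4 * (μ Set.univ + 1)) with hηdef
  have hη : 0 < η := by positivity
  obtain ⟨h, hgh, -⟩ := hg.exists_boundedContinuous_lintegral_sub_le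
    (ε := ((ε / 4 : ℝ≥0) : ℝ≥0∞)) (by simpa using hε.ne')
  obtain ⟨N, hN⟩ := exists_forall_dist_le_of_continuous e h.continuous (η := η)
    (by exact_mod_cast hη)
  -- From this index on, the partitions decide the first `N` coordinates, hence `h` up to `η`.
  let k := (Finset.range N).sup n
  have hcoord : ∀ i b, IsClopen {x | e x i = b} := fun i b =>
    (isClopen_discrete {b}).preimage ((continuous_apply i).comp e.continuous)
  have hidx : ∀ A ∈ 𝒮, ∃ i, a i = A := fun A hA => by rw [ha] at hA; exact hA
  let idx : MSet Ω → ℕ := fun A => if hA : A ∈ 𝒮 then (hidx A hA).choose else 0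
  have hidx' : ∀ A ∈ 𝒮, a (idx A) = A := fun A hA => by
    simp only [idx, hA, dite_true]
    exact (hidx A hA).choose_spec
  let L : MSet Ω → Set K := fun A => {x | e x (idx A) = true}
  have hLS : ∀ A ∈ 𝒮, φ ⁻¹' L A = A := fun A hA => by
    ext ω
    change e (φ ω) (idx A) = true ↔ _
    rw [hφ_apply, hidx' A hA]
  have hpS : ∀ A ∈ (p k).parts, A ∈ 𝒮 := fun A hA => Or.inr (Set.mem_iUnion.2 ⟨k, Or.inl hA⟩)
  have hqS : ∀ A ∈ (q (p k)).parts, A ∈ 𝒮 := fun A hA =>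
    Or.inr (Set.mem_iUnion.2 ⟨k, Or.inr hA⟩)
  have hconst : ∀ A ∈ (p k).parts, ∃ c : Z, ∀ᵐ x ∂ν.restrict (L A), ‖h x - c‖ₑ ≤ η := by
    intro A hA
    obtain ⟨ω₀, hω₀⟩ : (A : Set Ω).Nonempty := by
      rw [Set.nonempty_iff_ne_empty]
      exact fun h0 => (p k).ne_bot hA (Subtype.ext h0)
    refine ⟨h (φ ω₀), ?_⟩
    let W : Set K := ⋂ i ∈ Finset.range N, {x | e x i = e (φ ω₀) i}
    have hW : IsClopen W := isClopen_biInter_finset fun i _ => hcoord i _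
    -- The range of `φ` need not contain `L A`, but `ν` sees clopen sets only through their
    -- preimages, and this one has empty preimage.
    have hnull : ν (L A \ W) = 0 := by
      rw [hν _ ((hcoord _ _).diff hW)]
      have : φ ⁻¹' (L A \ W) = ∅ := by
        rw [Set.preimage_sdiff, hLS A (hpS A hA), Set.sdiff_eq_empty]
        intro ω hω
        refine Set.mem_iInter₂.2 fun i hi => ?_
        change e (φ ω) i = e (φ ω₀) i
        rw [Bool.eq_iff_iff, hφ_apply, hφ_apply]
        exact hn i k (Finset.le_sup hi) A hA ω hω ω₀ hω₀
      rw [this]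
      simp
    rw [ae_restrict_iff' (hcoord _ _).isOpen.measurableSet]
    filter_upwards [measure_eq_zero_iff_ae_notMem.1 hnull] with x hx hxA
    have hxW : x ∈ W := by
      by_contra hxW
      exact hx ⟨hxA, hxW⟩
    have h1 := hN x (φ ω₀) fun i hi => Set.mem_iInter₂.1 hxW i (Finset.mem_range.2 hi)
    rw [dist_eq_norm] at h1
    rw [← ofReal_norm]
    exact ENNReal.ofReal_le_of_le_toReal (by simpa using h1)
  have hfin := sum_enorm_deviation_le (μ := μ) (m := m) hg hν
    (fun S hS => (hG S hS).symm.trans (hgG S hS.isOpen.measurableSet))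
    (π := p k) (q := q (p k)) (L := L) (fun A => hcoord _ _)
    (fun A hA => hLS A (hpS A hA)) (fun A hA => hLS A (hqS A hA)) hconst
  refine absurd ((hq (p k)).trans_le hfin) (not_lt.2 ?_)
  have h1 : (η : ℝ≥0∞) * ν Set.univ ≤ (ε / 4 : ℝ≥0) := by
    rw [hν _ isClopen_univ, Set.preimage_univ, ← ENNReal.coe_mul, ENNReal.coe_le_coe, hηdef]
    calc ε / (4 * (μ Set.univ + 1)) * μ Set.univ
        ≤ ε / (4 * (μ Set.univ + 1)) * (μ Set.univ + 1) := by gcongr; exact le_self_add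
      _ = ε / 4 := by field_simp
  calc 2 * (∫⁻ x, ‖g x - h x‖ₑ ∂ν + η * ν Set.univ)
      ≤ 2 * ((ε / 4 : ℝ≥0) + (ε / 4 : ℝ≥0)) := by gcongr
    _ = ε := by
        rw [← ENNReal.coe_add, ← ENNReal.coe_ofNat, ← ENNReal.coe_mul]
        congr 1
        field_simp
        norm_num

/-- The Cantor space in an arbitrary universe. -/
def CantorSpace : Type w := ULift.{w} (ℕ → Bool)

namespace CantorSpace

instance : TopologicalSpace CantorSpace.{w} := inferInstanceAs (TopologicalSpace (ULift (ℕ → Bool)))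

/-- The canonical homeomorphism onto `ℕ → Bool`. -/
def homeo : CantorSpace.{w} ≃ₜ (ℕ → Bool) := Homeomorph.ulift

instance : CompactSpace CantorSpace.{w} := homeo.symm.compactSpace

instance : T2Space CantorSpace.{w} := homeo.isEmbedding.t2Space

instance : SecondCountableTopology CantorSpace.{w} := homeo.isEmbedding.secondCountableTopology

instance : TotallyDisconnectedSpace CantorSpace.{w} :=
  homeo.isEmbedding.isTotallyDisconnected_range.1
    (isTotallyDisconnected_of_totallyDisconnectedSpace _)

instance : MeasurableSpace CantorSpace.{w} := borel _

instance : BorelSpace CantorSpace.{w} := ⟨rfl⟩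

end CantorSpace

theorem isRegular_measure {K : Type*} [TopologicalSpace K] [CompactSpace K] [T2Space K]
    [SecondCountableTopology K] [MeasurableSpace K] [BorelSpace K] (ν : Measure K)
    [IsFiniteMeasure ν] : IsRegular (fun A => ν A) := by
  intro E hE ε hε
  have hε' : ((ε / 2 : ℝ≥0) : ℝ≥0∞) ≠ 0 := by simpa using hε.ne'
  obtain ⟨U, hEU, hU, -, hUE⟩ := hE.exists_isOpen_sdiff_lt (measure_ne_top ν E) hε'
  obtain ⟨F, hFE, hF, hEF⟩ := hE.exists_isClosed_sdiff_lt (measure_ne_top ν E) hε'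
  refine ⟨F, U, hF.isCompact, hU, hFE, hEU, ?_⟩
  calc ν (U \ F) ≤ ν (U \ E) + ν (E \ F) := by
        refine (measure_mono ?_).trans (measure_union_le _ _)
        intro x hx
        by_cases hxE : x ∈ E
        · exact Or.inr ⟨hxE, hx.2⟩
        · exact Or.inl ⟨hx.1, hxE⟩
    _ < (ε / 2 : ℝ≥0) + (ε / 2 : ℝ≥0) := ENNReal.add_lt_add hUE hEF
    _ = ε := by rw [← ENNReal.coe_add, add_halves]

theorem isRegular_variation_ofVectorMeasure {K Z : Type*} [TopologicalSpace K] [CompactSpace K]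
    [T2Space K] [SecondCountableTopology K] [MeasurableSpace K] [BorelSpace K]
    [NormedAddCommGroup Z] (G : VectorMeasure K Z)
    (hG : variation (ofVectorMeasure G) Set.univ ≠ ∞) :
    IsRegular (variation (ofVectorMeasure G)) := by
  rw [variation_ofVectorMeasure G MeasurableSet.univ] at hG
  have : IsFiniteMeasure G.variation := ⟨hG.lt_top⟩
  intro E hE ε hε
  obtain ⟨C, U, hC, hU, hCE, hEU, h⟩ := isRegular_measure G.variation E hE ε hε
  refine ⟨C, U, hC, hU, hCE, hEU, ?_⟩
  rwa [variation_ofVectorMeasure G (hU.measurableSet.diff hC.isClosed.measurableSet)]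

theorem UniformlyAbsCont.comp {Ω ι : Type*} [MeasurableSpace Ω] {ν : ι → Set Ω → ℝ≥0∞}
    {μ : FinAdd Ω ℝ≥0} (h : UniformlyAbsCont ν μ) (i : ι) :
    UniformlyAbsCont (fun _ : Unit => ν i) μ := fun ε hε => by
  obtain ⟨δ, hδ, hA⟩ := h ε hε
  exact ⟨δ, hδ, fun A hAm hμ _ => hA A hAm hμ i⟩

/-- The Radon–Nikodým property follows from the convergence of averages on the Cantor space. -/
theorem hasRNP_of_averagesConverge_cantor {Z : Type u} [NormedAddCommGroup Z] [NormedSpace ℝ Z]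
    [CompleteSpace Z]
    (h : ∀ (ν : Measure CantorSpace.{w}) [IsFiniteMeasure ν] (G : VectorMeasure CantorSpace.{w} Z),
      variation (ofVectorMeasure G) Set.univ ≠ ∞ →
      UniformlyAbsCont (fun _ : Unit => variation (ofVectorMeasure G)) (ofMeasure ν) →
      AveragesConverge (ofMeasure ν) (ofVectorMeasure G)) : HasRNP.{w₀} Z := by
  intro Ω _ μ _ G hG hac
  refine exists_density_of_averagesConverge μ (G := ofVectorMeasure G) ?_
  -- The hypothesis is used only on the Cantor space, where it gives densities; these give
  -- convergent averages on `Ω`. Hence the universe of `Ω` is unrestricted.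
  refine averagesConverge_of_cantor CantorSpace.homeo.{w} (fun ν _ G hG hac => ?_)
    (by rw [variation_ofVectorMeasure _ MeasurableSet.univ]; exact hG.ne)
    (uniformlyAbsCont_ofVectorMeasure hG hac)
  refine exists_density_of_averagesConverge ν (G := ofVectorMeasure G) (h ν G ?_ ?_)
  · rw [variation_ofVectorMeasure _ MeasurableSet.univ]
    exact hG.ne
  · exact uniformlyAbsCont_ofVectorMeasure hG hac

end Cantor

end CondExpOp

end

theorem theorem5 (X : Type u) (Y : Type v)
    [NormedAddCommGroup X] [NormedSpace ℝ X] [CompleteSpace X]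
    [NormedAddCommGroup Y] [NormedSpace ℝ Y] [CompleteSpace Y] [Nontrivial Y] :
    List.TFAE [
      CondExpOp.HasRNP.{w₀} (StrongDual ℝ X),
      ∀ (Ω : Type w₁) [MeasurableSpace Ω]
        (T : CondExpOp.USpace Ω X →L[ℝ] Y) (m : CondExpOp.FinAdd Ω (X →L[ℝ] Y))
        (μ : CondExpOp.FinAdd Ω ℝ≥0),
        CondExpOp.RepresentsU m T →
        IsCompactOperator T →
        CondExpOp.UniformlyAbsCont
          (fun y : Metric.closedBall (0 : StrongDual ℝ Y) 1 =>
            CondExpOp.variation (CondExpOp.dualComp m y)) μ →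
        Tendsto (fun π : CondExpOp.MPartition Ω => CondExpOp.condExpOp μ m π) atBot (𝓝 T),
      ∀ (H : Type w₂) [TopologicalSpace H] [CompactSpace H] [T2Space H]
        [MeasurableSpace H] [BorelSpace H]
        (T : C(H, X) →L[ℝ] Y)
        (m : CondExpOp.FinAdd H (X →L[ℝ] StrongDual ℝ (StrongDual ℝ Y)))
        (μ : CondExpOp.FinAdd H ℝ≥0),
        CondExpOp.RepresentsC m T →
        IsCompactOperator T →
        CondExpOp.UniformlyAbsCont
          (fun y : Metric.closedBall (0 : StrongDual ℝ Y) 1 =>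
            CondExpOp.variation (CondExpOp.bidualComp m y)) μ →
        CondExpOp.IsRegular (fun A => (μ A : ℝ≥0∞)) →
        Tendsto
          (fun π : CondExpOp.MPartition H =>
            (CondExpOp.condExpOp μ m π).comp (CondExpOp.contToU H X))
          atBot (𝓝 ((NormedSpace.inclusionInDoubleDual ℝ Y).comp T))] := by
  -- The Radon–Nikodým property is invoked only for measures on the Cantor space.
  tfae_have 1 → 2 := fun h1 Ω _ T m μ hmT hT hac =>
    CondExpOp.tendsto_condExpOp_of_averagesConverge hmT hT fun y hy =>
      CondExpOp.averagesConverge_of_cantor CondExpOp.CantorSpace.homeo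
        (fun ν _ G => h1 CondExpOp.CantorSpace ν G)
        (CondExpOp.variation_dualComp_ne_top hmT.1 y) (hac.comp ⟨y, hy⟩)
  tfae_have 1 → 3 := fun h1 H _ _ _ _ _ T m μ hmT hT hac _ =>
    CondExpOp.tendsto_condExpOp_comp_of_averagesConverge hmT hT fun y hy =>
      CondExpOp.averagesConverge_of_cantor CondExpOp.CantorSpace.homeo
        (fun ν _ G => h1 CondExpOp.CantorSpace ν G)
        (CondExpOp.variation_dualComp_ne_top hmT.1 _) (hac.comp ⟨y, hy⟩)
  tfae_have 2 → 1 := fun h2 =>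
    CondExpOp.hasRNP_of_averagesConverge_cantor fun ν _ G hG hac =>
      CondExpOp.averagesConverge_of_forall_tendsto
        (fun T m hmT hT hac => h2 CondExpOp.CantorSpace T m _ hmT hT hac) hG hac
  tfae_have 3 → 1 := fun h3 =>
    CondExpOp.hasRNP_of_averagesConverge_cantor fun ν _ G hG hac =>
      have hν : CondExpOp.IsRegular fun A => (CondExpOp.ofMeasure ν A : ℝ≥0∞) := by
        simp_rw [CondExpOp.coe_ofMeasure]
        exact CondExpOp.isRegular_measure ν
      CondExpOp.averagesConverge_of_forall_tendsto_comp hν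
        (fun T m hmT hT hac => h3 CondExpOp.CantorSpace T m _ hmT hT hac hν) hG
        (CondExpOp.isRegular_variation_ofVectorMeasure G hG) hac
  tfae_finish
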